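/- Consider active $\ell_1$ regression: given a known matrix $X\in\mathbb{R}^{n\times d}$ and a fixed unknown label vector $y\in\mathbb{R}^n$, a randomized learner (which may depend on $X$) adaptively queries row indices, is shown the label $y_i$ of each queried row $i$, and finally returns $\widehat\beta\in\mathbb{R}^d$. An algorithm, i.e. a choice of such a learner for every $X\in\mathbb{R}^{n\times d}$, solves the problem with accuracy $\varepsilon$ and failure probability $\delta$ if for every $X\in\mathbb{R}^{n\times d}$ and every $y\in\mathbb{R}^n$, with probability at least $1-\delta$ over the learner's randomness, $$\|X\widehat\beta-y\|_1\le(1+\varepsilon)\min_{\beta\in\mathbb{R}^d}\|X\beta-y\|_1 .$$ There are an absolute constant $c>0$ and a fixed polynomial $p$ in three variables such that for all integers $d\ge 1$ and all $0<\varepsilon<\frac1{10}$, $0<\delta<\frac14$ there is an $n\le p\left(d,\frac1\varepsilon,\log\frac1\delta\right)$ with the following property. For every algorithm that solves the problem for $n\times d$ matrices with accuracy $\varepsilon$ and failure probability $\delta$, there is an instance $(X,y)\in\mathbb{R}^{n\times d}\times\mathbb{R}^n$ on which, with positive probability, it queries at least $$c\left(d\log\frac1\delta+\frac{d}{\varepsilon^2}+\frac1{\varepsilon^2}\log\frac1\delta\right)$$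 labels. In particular, every algorithm that solves the problem with a fixed budget of $m$ queries has $m\ge c\left(d\log\frac1\delta+\frac{d}{\varepsilon^2}+\frac1{\varepsilon^2}\log\frac1\delta\right)$. -/

import Mathlib

universe u

namespace ActiveL1

/-- The `ℓ₁` regression objective `‖Xβ - y‖₁ = ∑ᵢ |(Xβ)ᵢ - yᵢ|`. -/
def l1Loss {n d : ℕ} (X : Matrix (Fin n) (Fin d) ℝ) (y : Fin n → ℝ) (β : Fin d → ℝ) : ℝ :=
  ∑ i, |(X.mulVec β) i - y i|

/-- A deterministic adaptive learner: either it stops and returns an estimate in `ℝᵈ`, or it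
queries the label of a row `i` and continues in a way that may depend on the label it is shown. -/
inductive QueryTree (n d : ℕ) : Type
  | output (β : Fin d → ℝ) : QueryTree n d
  | query (i : Fin n) (next : ℝ → QueryTree n d) : QueryTree n d

/-- The estimate returned when the hidden label vector is `y`. -/
def QueryTree.run {n d : ℕ} (y : Fin n → ℝ) : QueryTree n d → (Fin d → ℝ)
  | .output β => β
  | .query i next => (next (y i)).run y

/-- The number of label queries made when the hidden label vector is `y`. -/
def QueryTree.numQueries {n d : ℕ} (y : Fin n → ℝ) : QueryTree n d → ℕ
  | .output _ => 0
  | .query i next => (next (y i)).numQueries y + 1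

/-- A randomized adaptive learner: an arbitrary probability space of internal random seeds, and a
deterministic adaptive learner for every seed.  For every label vector the returned estimate is a
random vector. -/
structure RandomizedLearner (n d : ℕ) : Type (u + 1) where
  /-- the space of random seeds -/
  Seed : Type u
  [measurableSpace : MeasurableSpace Seed]
  /-- the law of the random seed -/
  law : MeasureTheory.Measure Seed
  [isProbabilityMeasure : MeasureTheory.IsProbabilityMeasure law]
  tree : Seed → QueryTree n d
  measurable_run : ∀ y : Fin n → ℝ, Measurable fun ω => (tree ω).run y

attribute [instance] RandomizedLearner.measurableSpace RandomizedLearner.isProbabilityMeasure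

/-- An algorithm for active `ℓ₁` regression with `n × d` data matrices.  The data matrix is known
in advance, so that the learner that is run may depend on it in an arbitrary way. -/
abbrev Algorithm (n d : ℕ) : Type (u + 1) :=
  Matrix (Fin n) (Fin d) ℝ → RandomizedLearner.{u} n d

/-- The algorithm solves active `ℓ₁` regression with accuracy `ε` and failure probability `δ`: for
every data matrix `X` and every label vector `y`, with probability at least `1 - δ` over the
randomness of the learner, the estimate it returns has loss at most `(1 + ε) min_β ‖Xβ - y‖₁`. -/
def Algorithm.Solves {n d : ℕ} (A : Algorithm.{u} n d) (ε δ : ℝ) : Prop :=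
  ∀ (X : Matrix (Fin n) (Fin d) ℝ) (y : Fin n → ℝ),
    1 - δ ≤ (A X).law.real
      {ω | ∀ β : Fin d → ℝ, l1Loss X y (((A X).tree ω).run y) ≤ (1 + ε) * l1Loss X y β}

end ActiveL1

namespace ActiveL1

open Finset

/-! ### Products of Bernoulli laws as weighted finite sums -/

/-! Each of the three terms comes from its own hard prior, built from matrices whose rows are
standard basis vectors. For such a matrix the regression splits into one-dimensional median
problems, one per cluster of equal rows. The labels are independent bits. By averaging
(`RandomizedLearner.exists_tree`), a randomized learner can be replaced by a deterministic query
tree that does well on average over the prior.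

For `log(1/δ)/ε²`, all rows are equal and the bits have bias `+2ε` or `-2ε`. For `d/ε²` there are
`d` clusters, each with an independent random sign of a bias `4ε`; an accurate output must recover
most signs. For `d log(1/δ)`, either all labels are zero, which forces the output `0`, or one random
cluster has mostly ones; the learner stays on the all-zero path with probability exponentially small
in its queries to that cluster, and then errs.

The inductions on the tree carry unnormalised weights `a`, `b` of two hypotheses and the potential
`harm a b = ab/(a+b)`. By `harm_split`, a query to a bit of bias `±η` keeps at least the fraction `1
- 4η²` of it. At a leaf the potential bounds the error from below, since it is at most `min a b`.
The multiplicative form (`QueryTree.pow_mul_harm_le`) suits tiny `δ`; the additive form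
(`QueryTree.two_point_le`) charges only queries to the relevant cluster, so it can be summed over
clusters.

Each prior refutes a query count below its own term, and the constant `c` is small enough for one of
them always to apply. -/

/-- The probability of `b` under the Bernoulli law with parameter `p`. -/
def bern (p : ℝ) (b : Bool) : ℝ := if b then p else 1 - p

/-- The numerical value of a bit. -/
def bit (b : Bool) : ℝ := if b then 1 else 0

@[simp] lemma bern_true (p : ℝ) : bern p true = p := rfl
@[simp] lemma bern_false (p : ℝ) : bern p false = 1 - p := rfl
@[simp] lemma bit_true : bit true = 1 := rfl
@[simp] lemma bit_false : bit false = 0 := rfl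

/-- The label vector with the given bits. -/
def labels {ι : Type*} (y : ι → Bool) (i : ι) : ℝ := bit (y i)

section Bern

variable {ι : Type*}

/-- The assignment `y` is compatible with the deterministic coordinates of `p`. -/
def Compatible (p : ι → ℝ) (y : ι → Bool) : Prop :=
  ∀ i, (p i = 1 → y i = true) ∧ (p i = 0 → y i = false)

lemma bern_nonneg {p : ℝ} (h : p ∈ Set.Icc (0 : ℝ) 1) (b : Bool) : 0 ≤ bern p b := by
  cases b <;> simp [h.1, h.2]

lemma compatible_update_one [DecidableEq ι] {p : ι → ℝ} {i : ι} {y : ι → Bool}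
    (h : Compatible (Function.update p i 1) y) : y i = true :=
  (h i).1 (by simp)

lemma compatible_update_zero [DecidableEq ι] {p : ι → ℝ} {i : ι} {y : ι → Bool}
    (h : Compatible (Function.update p i 0) y) : y i = false :=
  (h i).2 (by simp)

lemma update_mem_Icc [DecidableEq ι] {p : ι → ℝ} (h : ∀ i, p i ∈ Set.Icc (0 : ℝ) 1) (i : ι) {v : ℝ}
    (hv : v ∈ Set.Icc (0 : ℝ) 1) (k : ι) : Function.update p i v k ∈ Set.Icc (0 : ℝ) 1 := by
  by_cases hk : k = i
  · subst hk; simpa using hv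
  · simpa [hk] using h k

variable [Fintype ι]

lemma prod_bern_nonneg {p : ι → ℝ} (h : ∀ i, p i ∈ Set.Icc (0 : ℝ) 1) (y : ι → Bool) :
    0 ≤ ∏ i, bern (p i) (y i) :=
  prod_nonneg fun i _ => bern_nonneg (h i) _

lemma prod_bern_eq_zero {p : ι → ℝ} {y : ι → Bool} (h : ¬ Compatible p y) :
    ∏ i, bern (p i) (y i) = 0 := by
  simp only [Compatible, not_forall] at h
  obtain ⟨i, hi⟩ := h
  refine prod_eq_zero (mem_univ i) ?_
  cases hy : y i <;> simp_all

variable [DecidableEq ι]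

/-- The expectation of `f` under the product of the Bernoulli laws with parameters `p i`. -/
def bernExp (p : ι → ℝ) (f : (ι → Bool) → ℝ) : ℝ :=
  ∑ y, (∏ i, bern (p i) (y i)) * f y

lemma bernExp_mono {p : ι → ℝ} (h : ∀ i, p i ∈ Set.Icc (0 : ℝ) 1) {f g : (ι → Bool) → ℝ}
    (hfg : ∀ y, Compatible p y → f y ≤ g y) : bernExp p f ≤ bernExp p g := by
  refine sum_le_sum fun y _ => ?_
  by_cases hy : Compatible p y
  · exact mul_le_mul_of_nonneg_left (hfg y hy) (prod_bern_nonneg h y)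
  · simp [prod_bern_eq_zero hy]

lemma bernExp_congr {p : ι → ℝ} {f g : (ι → Bool) → ℝ}
    (hfg : ∀ y, Compatible p y → f y = g y) : bernExp p f = bernExp p g := by
  refine sum_congr rfl fun y _ => ?_
  by_cases hy : Compatible p y
  · rw [hfg y hy]
  · simp [prod_bern_eq_zero hy]

lemma bernExp_add (p : ι → ℝ) (f g : (ι → Bool) → ℝ) :
    bernExp p (fun y => f y + g y) = bernExp p f + bernExp p g := by
  simp [bernExp, mul_add, sum_add_distrib]

lemma bernExp_const_mul (p : ι → ℝ) (c : ℝ) (f : (ι → Bool) → ℝ) :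
    bernExp p (fun y => c * f y) = c * bernExp p f := by
  simp only [bernExp, mul_sum]
  exact sum_congr rfl fun y _ => by ring

lemma bernExp_sum {κ : Type*} (s : Finset κ) (p : ι → ℝ) (f : κ → (ι → Bool) → ℝ) :
    bernExp p (fun y => ∑ k ∈ s, f k y) = ∑ k ∈ s, bernExp p (f k) := by
  simp only [bernExp, mul_sum]
  exact sum_comm

lemma bernExp_prod (p : ι → ℝ) (g : ι → Bool → ℝ) :
    bernExp p (fun y => ∏ i, g i (y i)) = ∏ i, (p i * g i true + (1 - p i) * g i false) := by
  have h := Finset.prod_univ_sum (fun _ : ι => (univ : Finset Bool))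
    (fun i b => bern (p i) b * g i b)
  simp only [Fintype.sum_bool, bern_true, bern_false, Fintype.piFinset_univ] at h
  rw [h, bernExp]
  exact sum_congr rfl fun y _ => prod_mul_distrib.symm

lemma bernExp_const (p : ι → ℝ) (c : ℝ) : bernExp p (fun _ => c) = c := by
  have h1 : bernExp p (fun _ => (1 : ℝ)) = 1 := by
    simpa using bernExp_prod p (fun _ _ => 1)
  simpa [h1] using bernExp_const_mul p c (fun _ => 1)

lemma bernExp_nonneg {p : ι → ℝ} (h : ∀ i, p i ∈ Set.Icc (0 : ℝ) 1) {f : (ι → Bool) → ℝ}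
    (hf : ∀ y, 0 ≤ f y) : 0 ≤ bernExp p f :=
  sum_nonneg fun y _ => mul_nonneg (prod_bern_nonneg h y) (hf y)

/-- Conditioning on the bit at `i`. -/
lemma bernExp_split (p : ι → ℝ) (i : ι) (f : (ι → Bool) → ℝ) :
    bernExp p f = p i * bernExp (Function.update p i 1) f
      + (1 - p i) * bernExp (Function.update p i 0) f := by
  have key : ∀ (v : ℝ) (y : ι → Bool), ∏ k, bern (Function.update p i v k) (y k)
      = bern v (y i) * ∏ k ∈ univ.erase i, bern (p k) (y k) := by
    intro v y
    rw [← mul_prod_erase univ _ (mem_univ i), Function.update_self]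
    congr 1
    refine prod_congr rfl fun k hk => ?_
    rw [Function.update_of_ne (ne_of_mem_erase hk)]
  simp only [bernExp, mul_sum, ← sum_add_distrib]
  refine sum_congr rfl fun y _ => ?_
  rw [key, key, ← mul_prod_erase univ _ (mem_univ i)]
  cases y i <;> simp <;> ring

/-- Distinct bits are uncorrelated. The product is written with factors indexed by all coordinates,
equal to `1` away from `i` and `k`, so that `bernExp_prod` applies. -/
lemma bernExp_centered_mul (p : ι → ℝ) (i k : ι) :
    bernExp p (fun y => (bit (y i) - p i) * (bit (y k) - p k))
      = if i = k then p i * (1 - p i) else 0 := by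
  have h := bernExp_prod p (fun l b => (if l = i then bit b - p l else 1) *
    (if l = k then bit b - p l else 1))
  have h1 : ∀ y : ι → Bool, ∏ l, ((if l = i then bit (y l) - p l else 1) *
      (if l = k then bit (y l) - p l else 1)) = (bit (y i) - p i) * (bit (y k) - p k) := by
    intro y
    rw [prod_mul_distrib]
    simp
  simp only [h1] at h
  rw [h]
  split_ifs with hik
  · subst hik
    rw [prod_eq_single i (fun l _ hl => by simp [hl]) (by simp)]
    simp
    ring
  · refine prod_eq_zero (mem_univ i) ?_
    simp [hik]
    ring

lemma bernExp_sq_le (p : ι → ℝ) (s : Finset ι) :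
    bernExp p (fun y => (∑ i ∈ s, (bit (y i) - p i)) ^ 2) ≤ s.card / 4 := by
  have h : ∀ y : ι → Bool, (∑ i ∈ s, (bit (y i) - p i)) ^ 2
      = ∑ i ∈ s, ∑ k ∈ s, (bit (y i) - p i) * (bit (y k) - p k) := fun y => by
    rw [sq, sum_mul_sum]
  simp only [h, bernExp_sum, bernExp_centered_mul]
  have : ∀ i ∈ s, (∑ k ∈ s, if i = k then p i * (1 - p i) else 0) ≤ 1 / 4 := by
    intro i hi
    rw [sum_ite_eq, if_pos hi]
    nlinarith [sq_nonneg (p i - 1 / 2)]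
  calc _ ≤ ∑ i ∈ s, (1 / 4 : ℝ) := sum_le_sum this
    _ = _ := by simp; ring

/-- Chebyshev's inequality, as a lower bound for the expectation of a function that is at least
`1` when a sum of independent bits is close to its mean. -/
lemma le_bernExp_of_close {p : ι → ℝ} (h : ∀ i, p i ∈ Set.Icc (0 : ℝ) 1) (s : Finset ι) {t : ℝ}
    (ht : 0 < t) {f : (ι → Bool) → ℝ} (hf0 : ∀ y, 0 ≤ f y)
    (hf : ∀ y, Compatible p y → |∑ i ∈ s, (bit (y i) - p i)| < t → 1 ≤ f y) :
    1 - s.card / (4 * t ^ 2) ≤ bernExp p f := by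
  have h1 : bernExp p (fun y => 1 + (-1 / t ^ 2) * (∑ i ∈ s, (bit (y i) - p i)) ^ 2)
      ≤ bernExp p f := by
    refine bernExp_mono h fun y hy => ?_
    by_cases hc : |∑ i ∈ s, (bit (y i) - p i)| < t
    · refine le_trans ?_ (hf y hy hc)
      have : 0 ≤ 1 / t ^ 2 * (∑ i ∈ s, (bit (y i) - p i)) ^ 2 := by positivity
      rw [neg_div]; linarith
    · refine le_trans ?_ (hf0 y)
      have h2 : t ^ 2 ≤ (∑ i ∈ s, (bit (y i) - p i)) ^ 2 := by
        rw [← sq_abs (∑ i ∈ s, (bit (y i) - p i))]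
        exact pow_le_pow_left₀ ht.le (not_lt.1 hc) 2
      have h3 : 1 ≤ (∑ i ∈ s, (bit (y i) - p i)) ^ 2 / t ^ 2 := by
        rwa [one_le_div (by positivity)]
      have h4 : -1 / t ^ 2 * (∑ i ∈ s, (bit (y i) - p i)) ^ 2
        = -((∑ i ∈ s, (bit (y i) - p i)) ^ 2 / t ^ 2) := by ring
      rw [h4]; linarith
  rw [bernExp_add, bernExp_const, bernExp_const_mul] at h1
  have h5 := bernExp_sq_le p s
  have h6 : 1 / t ^ 2 * bernExp p (fun y => (∑ i ∈ s, (bit (y i) - p i)) ^ 2)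
      ≤ 1 / t ^ 2 * (s.card / 4) := mul_le_mul_of_nonneg_left h5 (by positivity)
  have h7 : (s.card : ℝ) / (4 * t ^ 2) = 1 / t ^ 2 * (s.card / 4) := by
    field_simp
  rw [h7]
  rw [neg_div] at h1
  linarith

end Bern

/-! ### From randomized learners to deterministic ones -/

open Classical in
/-- The indicator of the event that `b` is not a `(1 + ε)`-approximate solution. -/
noncomputable def failInd {n d : ℕ} (X : Matrix (Fin n) (Fin d) ℝ) (ε : ℝ) (b : Fin d → ℝ)
    (y : Fin n → ℝ) : ℝ :=
  if ∃ β, (1 + ε) * l1Loss X y β < l1Loss X y b then 1 else 0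

lemma failInd_nonneg {n d : ℕ} (X : Matrix (Fin n) (Fin d) ℝ) (ε : ℝ) (b : Fin d → ℝ)
    (y : Fin n → ℝ) : 0 ≤ failInd X ε b y := by
  unfold failInd; split_ifs <;> norm_num

lemma failInd_eq_one {n d : ℕ} {X : Matrix (Fin n) (Fin d) ℝ} {ε : ℝ} {b : Fin d → ℝ}
    {y : Fin n → ℝ} (β : Fin d → ℝ) (h : (1 + ε) * l1Loss X y β < l1Loss X y b) :
    failInd X ε b y = 1 :=
  if_pos ⟨β, h⟩

lemma continuous_l1Loss {n d : ℕ} (X : Matrix (Fin n) (Fin d) ℝ) (y : Fin n → ℝ) :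
    Continuous (l1Loss X y) := by
  unfold l1Loss Matrix.mulVec dotProduct
  fun_prop

lemma isClosed_approx {n d : ℕ} (X : Matrix (Fin n) (Fin d) ℝ) (y : Fin n → ℝ) (ε : ℝ) :
    IsClosed {b : Fin d → ℝ | ∀ β, l1Loss X y b ≤ (1 + ε) * l1Loss X y β} := by
  rw [Set.ofPred_forall]
  exact isClosed_iInter fun β => isClosed_le (continuous_l1Loss X y) continuous_const

lemma RandomizedLearner.integral_failInd {n d : ℕ} (L : RandomizedLearner.{u} n d)
    (X : Matrix (Fin n) (Fin d) ℝ) (ε δ : ℝ) (y : Fin n → ℝ)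
    (h : 1 - δ ≤ L.law.real {ω | ∀ β, l1Loss X y ((L.tree ω).run y) ≤ (1 + ε) * l1Loss X y β}) :
    MeasureTheory.Integrable (fun ω => failInd X ε ((L.tree ω).run y) y) L.law ∧
      ∫ ω, failInd X ε ((L.tree ω).run y) y ∂L.law ≤ δ := by
  have hS : MeasurableSet
      {ω | ∀ β, l1Loss X y ((L.tree ω).run y) ≤ (1 + ε) * l1Loss X y β} :=
    L.measurable_run y (isClosed_approx X y ε).measurableSet
  set S := {ω | ∀ β, l1Loss X y ((L.tree ω).run y) ≤ (1 + ε) * l1Loss X y β}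
  have heq : (fun ω => failInd X ε ((L.tree ω).run y) y) = Sᶜ.indicator 1 := by
    ext ω
    by_cases hω : ω ∈ S
    · rw [Set.indicator_of_notMem (by simpa using hω)]
      refine if_neg ?_
      push Not
      exact hω
    · rw [Set.indicator_of_mem (by simpa using hω)]
      simp only [S, Set.mem_ofPred_eq, not_forall, not_le] at hω
      exact if_pos hω
  rw [heq]
  refine ⟨(MeasureTheory.integrable_const (1 : ℝ)).indicator hS.compl, ?_⟩
  rw [MeasureTheory.integral_indicator_one hS.compl, MeasureTheory.probReal_compl_eq_one_sub hS]
  linarith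

/-- A randomized learner that succeeds with probability `1 - δ` on all label vectors contains a
deterministic one that succeeds with probability `1 - δ` over a given prior of label vectors. -/
lemma RandomizedLearner.exists_tree {n d : ℕ} (L : RandomizedLearner.{u} n d)
    (X : Matrix (Fin n) (Fin d) ℝ) (ε δ T : ℝ)
    (hsolve : ∀ y : Fin n → ℝ, 1 - δ ≤ L.law.real
      {ω | ∀ β : Fin d → ℝ, l1Loss X y ((L.tree ω).run y) ≤ (1 + ε) * l1Loss X y β})
    (hT : ∀ y : Fin n → ℝ, L.law {ω | T ≤ ((L.tree ω).numQueries y : ℝ)} = 0)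
    {κ : Type*} [Fintype κ] (q : κ → ℝ) (hq : ∀ k, 0 ≤ q k) (hq1 : ∑ k, q k = 1)
    (p : κ → Fin n → ℝ) (hp : ∀ k i, p k i ∈ Set.Icc (0 : ℝ) 1) :
    ∃ t : QueryTree n d, (∀ y : Fin n → Bool, (t.numQueries (labels y) : ℝ) < T) ∧
      ∑ k, q k * bernExp (p k) (fun y => failInd X ε (t.run (labels y)) (labels y)) ≤ δ := by
  have hint := fun y => L.integral_failInd X ε δ y (hsolve y)
  -- The prior lives on finitely many bit vectors, so a single null set covers all seeds that ask
  -- too many queries; no measurability of the query count is needed.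
  have hnull : L.law (⋃ y : Fin n → Bool, {ω | T ≤ ((L.tree ω).numQueries (labels y) : ℝ)}) = 0 :=
    MeasureTheory.measure_iUnion_null fun y => hT _
  have hintE : ∀ k, MeasureTheory.Integrable (fun ω => q k * bernExp (p k)
      (fun y => failInd X ε ((L.tree ω).run (labels y)) (labels y))) L.law := fun k =>
    (MeasureTheory.integrable_finsetSum _ fun y _ =>
      ((hint (labels y)).1.const_mul _)).const_mul _
  obtain ⟨ω, hω, hle⟩ := MeasureTheory.exists_notMem_null_le_integral
    (MeasureTheory.integrable_finsetSum univ fun k _ => hintE k) hnull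
  refine ⟨L.tree ω, fun y => ?_, hle.trans ?_⟩
  · by_contra hc
    exact hω (Set.mem_iUnion.2 ⟨y, not_lt.1 hc⟩)
  · rw [MeasureTheory.integral_finsetSum _ fun k _ => hintE k]
    calc _ ≤ ∑ k, q k * δ := by
          refine sum_le_sum fun k _ => ?_
          rw [MeasureTheory.integral_const_mul]
          refine mul_le_mul_of_nonneg_left ?_ (hq k)
          unfold bernExp
          rw [MeasureTheory.integral_finsetSum _ fun y _ => (hint (labels y)).1.const_mul _]
          calc _ ≤ ∑ y : Fin n → Bool, (∏ i, bern (p k i) (y i)) * δ := by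
                refine sum_le_sum fun y _ => ?_
                rw [MeasureTheory.integral_const_mul]
                exact mul_le_mul_of_nonneg_left (hint (labels y)).2 (prod_bern_nonneg (hp k) y)
            _ = δ := bernExp_const (p k) δ
      _ = δ := by rw [← sum_mul, hq1, one_mul]

/-! ### Query trees on independent bits -/

/-- The number of queries to rows in `S`, when the hidden label vector is `y`. -/
def QueryTree.numQueriesIn {n d : ℕ} (S : Finset (Fin n)) (y : Fin n → ℝ) : QueryTree n d → ℕ
  | .output _ => 0
  | .query i next => (next (y i)).numQueriesIn S y + if i ∈ S then 1 else 0

lemma QueryTree.sum_numQueriesIn {n d : ℕ} (g : Fin n → Fin d) (y : Fin n → ℝ)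
    (t : QueryTree n d) :
    ∑ j, t.numQueriesIn {i | g i = j} y = t.numQueries y := by
  induction t with
  | output β => simp [numQueriesIn, numQueries]
  | query i next ih => simp [numQueriesIn, numQueries, sum_add_distrib, ih]

lemma QueryTree.numQueriesIn_le {n d : ℕ} (S : Finset (Fin n)) (y : Fin n → ℝ)
    (t : QueryTree n d) : t.numQueriesIn S y ≤ t.numQueries y := by
  induction t with
  | output β => simp [numQueriesIn, numQueries]
  | query i next ih =>
    simp only [numQueriesIn, numQueries]
    have := ih (y i)
    split_ifs <;> omega

lemma labels_eq_one {n : ℕ} {y : Fin n → Bool} {i : Fin n} (h : y i = true) : labels y i = 1 := by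
  simp [labels, h]

lemma labels_eq_zero {n : ℕ} {y : Fin n → Bool} {i : Fin n} (h : y i = false) :
    labels y i = 0 := by
  simp [labels, h]

/-- After an answer the conditional law is again a product, with the parameter of the queried row
set to `0` or `1`. This is what lets the inductions on trees generalise over `p`, and it makes a
repeated query harmless. -/
lemma bernExp_run_query {n d : ℕ} (p : Fin n → ℝ) (i : Fin n) (next : ℝ → QueryTree n d)
    (F : (Fin d → ℝ) → (Fin n → Bool) → ℝ) :
    bernExp p (fun y => F ((QueryTree.query i next).run (labels y)) y)
      = p i * bernExp (Function.update p i 1) (fun y => F ((next 1).run (labels y)) y)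
        + (1 - p i) * bernExp (Function.update p i 0)
          (fun y => F ((next 0).run (labels y)) y) := by
  rw [bernExp_split p i]
  congr 2
  · refine bernExp_congr fun y hy => ?_
    rw [QueryTree.run, labels_eq_one (compatible_update_one hy)]
  · refine bernExp_congr fun y hy => ?_
    rw [QueryTree.run, labels_eq_zero (compatible_update_zero hy)]

lemma bernExp_numQueriesIn_query {n d : ℕ} (S : Finset (Fin n)) (p : Fin n → ℝ) (i : Fin n)
    (next : ℝ → QueryTree n d) :
    bernExp p (fun y => ((QueryTree.query i next).numQueriesIn S (labels y) : ℝ))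
      = p i * bernExp (Function.update p i 1) (fun y => ((next 1).numQueriesIn S (labels y) : ℝ))
        + (1 - p i) * bernExp (Function.update p i 0)
          (fun y => ((next 0).numQueriesIn S (labels y) : ℝ)) + if i ∈ S then 1 else 0 := by
  have h : bernExp p (fun y => ((QueryTree.query i next).numQueriesIn S (labels y) : ℝ))
      = bernExp p (fun y => ((next (labels y i)).numQueriesIn S (labels y) : ℝ))
        + if i ∈ S then 1 else 0 := by
    rw [← bernExp_const p (if i ∈ S then (1 : ℝ) else 0), ← bernExp_add]
    simp only [QueryTree.numQueriesIn]
    push_cast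
    rfl
  rw [h, bernExp_split p i]
  congr 3
  · refine bernExp_congr fun y hy => ?_
    rw [labels_eq_one (compatible_update_one hy)]
  · refine bernExp_congr fun y hy => ?_
    rw [labels_eq_zero (compatible_update_zero hy)]

/-- Half of the harmonic mean. -/
noncomputable def harm (a b : ℝ) : ℝ := a * b / (a + b)

/-- Homogeneity: a query whose answer has the same law under both hypotheses scales both weights
alike, so it costs no potential. -/
lemma harm_mul {v : ℝ} (a b : ℝ) : harm (a * v) (b * v) = harm a b * v := by
  unfold harm
  by_cases hv : v = 0
  · simp [hv]
  by_cases hab : a + b = 0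
  · rw [← add_mul, hab]; simp
  · rw [← add_mul]; field_simp

lemma harm_le_left {a b : ℝ} (ha : 0 ≤ a) (hb : 0 ≤ b) : harm a b ≤ a := by
  unfold harm
  rcases (add_nonneg ha hb).eq_or_lt with h | h
  · rw [← h]; simpa using ha
  · rw [div_le_iff₀ h]; nlinarith

lemma harm_comm (a b : ℝ) : harm a b = harm b a := by
  unfold harm; rw [mul_comm, add_comm]

lemma harm_le_right {a b : ℝ} (ha : 0 ≤ a) (hb : 0 ≤ b) : harm a b ≤ b := by
  rw [harm_comm]; exact harm_le_left hb ha

lemma harm_nonneg {a b : ℝ} (ha : 0 ≤ a) (hb : 0 ≤ b) : 0 ≤ harm a b := by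
  unfold harm; positivity

lemma four_mul_harm_le {a b : ℝ} (ha : 0 ≤ a) (hb : 0 ≤ b) : 4 * harm a b ≤ a + b := by
  unfold harm
  rcases (add_nonneg ha hb).eq_or_lt with h | h
  · rw [← h]; simp
  · rw [mul_div_assoc', div_le_iff₀ h]; nlinarith [sq_nonneg (a - b)]

/-- The loss of `harm` in one query to a bit of bias `±η`. -/
lemma harm_split {a b η : ℝ} (ha : 0 ≤ a) (hb : 0 ≤ b) (hη : 0 ≤ η) (hη2 : η < 1 / 2) :
    (1 - 4 * η ^ 2) * harm a b ≤ harm (a * (1 / 2 + η)) (b * (1 / 2 - η))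
      + harm (a * (1 / 2 - η)) (b * (1 / 2 + η)) := by
  rcases (add_nonneg ha hb).eq_or_lt with h | h
  · have h1 : a = 0 := by linarith
    have h2 : b = 0 := by linarith
    simp [h1, h2, harm]
  · have hp : 0 < 1 / 2 + η := by linarith
    have hq : 0 < 1 / 2 - η := by linarith
    have hu : 0 < a * (1 / 2 + η) + b * (1 / 2 - η) := by
      rcases ha.eq_or_lt with h0 | h0
      · have : 0 < b := by linarith
        positivity
      · positivity
    have hv : 0 < a * (1 / 2 - η) + b * (1 / 2 + η) := by
      rcases ha.eq_or_lt with h0 | h0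
      · have : 0 < b := by linarith
        positivity
      · positivity
    unfold harm
    rw [div_add_div _ _ hu.ne' hv.ne', mul_div_assoc', div_le_div_iff₀ h (by positivity)]
    have key : (a * (1 / 2 + η) * (b * (1 / 2 - η)) * (a * (1 / 2 - η) + b * (1 / 2 + η)) +
        (a * (1 / 2 + η) + b * (1 / 2 - η)) * (a * (1 / 2 - η) * (b * (1 / 2 + η)))) * (a + b) -
        (1 - 4 * η ^ 2) * (a * b) * ((a * (1 / 2 + η) + b * (1 / 2 - η)) *
          (a * (1 / 2 - η) + b * (1 / 2 + η)))
        = (1 - 4 * η ^ 2) * (a * b) * (η * (a - b)) ^ 2 := by ring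
    have h4 : 0 ≤ 1 - 4 * η ^ 2 := by nlinarith
    have : 0 ≤ (1 - 4 * η ^ 2) * (a * b) * (η * (a - b)) ^ 2 := by positivity
    linarith

/-- Two-point lower bound with small failure probability: a tree with at most `T` queries cannot
be right both under `p₀` and under `p₁`. -/
theorem QueryTree.pow_mul_harm_le {n d : ℕ} {η : ℝ} (hη : 0 ≤ η) (hη2 : η < 1 / 2) (k : ℕ)
    (F : (Fin d → ℝ) → (Fin n → Bool) → ℝ) (hF : ∀ b y, 0 ≤ F b y)
    (hleaf : ∀ (R : Finset (Fin n)) (p₀ p₁ : Fin n → ℝ),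
      (∀ i ∈ R, p₀ i = 1 / 2 + η ∧ p₁ i = 1 / 2 - η) →
      (∀ i ∉ R, (p₀ i = 0 ∨ p₀ i = 1) ∧ p₁ i = p₀ i) → Rᶜ.card ≤ k →
      ∀ b, 1 / 2 ≤ bernExp p₀ (F b) ∨ 1 / 2 ≤ bernExp p₁ (F b))
    (t : QueryTree n d) : ∀ (T : ℕ) (R : Finset (Fin n)) (p₀ p₁ : Fin n → ℝ),
      (∀ i ∈ R, p₀ i = 1 / 2 + η ∧ p₁ i = 1 / 2 - η) →
      (∀ i ∉ R, (p₀ i = 0 ∨ p₀ i = 1) ∧ p₁ i = p₀ i) → Rᶜ.card + T ≤ k →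
      (∀ y, Compatible p₀ y → t.numQueries (labels y) ≤ T) →
      ∀ a b : ℝ, 0 ≤ a → 0 ≤ b →
      1 / 2 * ((1 - 4 * η ^ 2) ^ T * harm a b)
        ≤ a * bernExp p₀ (fun y => F (t.run (labels y)) y)
          + b * bernExp p₁ (fun y => F (t.run (labels y)) y) := by
  have hr0 : 0 ≤ 1 - 4 * η ^ 2 := by nlinarith
  have hr1 : 1 - 4 * η ^ 2 ≤ 1 := by nlinarith
  have hIcc : ∀ (R : Finset (Fin n)) (p₀ p₁ : Fin n → ℝ),
      (∀ i ∈ R, p₀ i = 1 / 2 + η ∧ p₁ i = 1 / 2 - η) →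
      (∀ i ∉ R, (p₀ i = 0 ∨ p₀ i = 1) ∧ p₁ i = p₀ i) →
      (∀ i, p₀ i ∈ Set.Icc (0 : ℝ) 1) ∧ ∀ i, p₁ i ∈ Set.Icc (0 : ℝ) 1 := by
    intro R p₀ p₁ h1 h2
    refine ⟨fun i => ?_, fun i => ?_⟩
    all_goals
      by_cases hi : i ∈ R
      · obtain ⟨h3, h4⟩ := h1 i hi
        first | rw [h3] | rw [h4]
        constructor <;> linarith
      · obtain ⟨h3 | h3, h4⟩ := h2 i hi
        all_goals first | rw [h4, h3] | rw [h3]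
        all_goals norm_num
  induction t with
  | output β =>
    intro T R p₀ p₁ h1 h2 hk hN a b ha hb
    obtain ⟨hp0, hp1⟩ := hIcc R p₀ p₁ h1 h2
    have hh := harm_nonneg ha hb
    have hpow : (1 - 4 * η ^ 2) ^ T * harm a b ≤ harm a b :=
      mul_le_of_le_one_left hh (pow_le_one₀ hr0 hr1)
    have e0 := bernExp_nonneg hp0 (hF β)
    have e1 := bernExp_nonneg hp1 (hF β)
    simp only [run]
    -- One hypothesis has error at least `1/2` here, and `harm a b` is at most the weight of either.
    rcases hleaf R p₀ p₁ h1 h2 (by omega) β with h | h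
    · have := harm_le_left ha hb
      nlinarith [mul_nonneg hb e1]
    · have := harm_le_right ha hb
      nlinarith [mul_nonneg ha e0]
  | query i next ih =>
    intro T R p₀ p₁ h1 h2 hk hN a b ha hb
    obtain ⟨hp0, hp1⟩ := hIcc R p₀ p₁ h1 h2
    by_cases hi : i ∈ R
    · obtain ⟨h3, h4⟩ := h1 i hi
      obtain ⟨T, rfl⟩ : ∃ T', T = T' + 1 := by
        obtain ⟨y, hy⟩ : ∃ y, Compatible p₀ y :=
          ⟨fun i => decide (p₀ i = 1), fun i => ⟨fun h => by simp [h], fun h => by simp [h]⟩⟩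
        have := hN y hy
        simp only [numQueries] at this
        exact ⟨T - 1, by omega⟩
      have step : ∀ (v : ℝ) (c : Bool), (v = 0 ∧ c = false ∨ v = 1 ∧ c = true) →
          ∀ a b : ℝ, 0 ≤ a → 0 ≤ b →
          1 / 2 * ((1 - 4 * η ^ 2) ^ T * harm a b)
          ≤ a * bernExp (Function.update p₀ i v) (fun y => F ((next v).run (labels y)) y)
            + b * bernExp (Function.update p₁ i v) (fun y => F ((next v).run (labels y)) y) := by
        intro v c hvc a b ha hb
        refine ih v T (R.erase i) _ _ ?_ ?_ ?_ ?_ a b ha hb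
        · intro l hl
          rw [mem_erase] at hl
          simpa [hl.1] using h1 l hl.2
        · intro l hl
          by_cases hli : l = i
          · subst hli
            simp only [Function.update_self, and_true]
            tauto
          · simp only [mem_erase, ne_eq, hli, not_false_eq_true, true_and] at hl
            simpa [hli] using h2 l hl
        · have e1 := card_compl R
          have e2 := card_compl (R.erase i)
          have e3 := card_erase_of_mem hi
          have e4 : 0 < R.card := card_pos.2 ⟨i, hi⟩
          have e5 := card_le_univ R
          omega
        · intro y hy
          have hyi : y i = c := by
            rcases hvc with ⟨rfl, rfl⟩ | ⟨rfl, rfl⟩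
            · exact compatible_update_zero hy
            · exact compatible_update_one hy
          have hyl : labels y i = v := by
            rcases hvc with ⟨rfl, rfl⟩ | ⟨rfl, rfl⟩
            · exact labels_eq_zero hyi
            · exact labels_eq_one hyi
          have := hN y (fun l => by
            by_cases hli : l = i
            · subst hli
              rw [h3]
              exact ⟨fun h => by linarith, fun h => by linarith⟩
            · simpa [hli] using hy l)
          simp only [numQueries, hyl] at this
          omega
      rw [bernExp_run_query, bernExp_run_query, h3, h4]
      have s1 := step 1 true (by simp) (a * (1 / 2 + η)) (b * (1 / 2 - η))
        (by nlinarith) (by nlinarith)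
      have s0 := step 0 false (by simp) (a * (1 / 2 - η)) (b * (1 / 2 + η))
        (by nlinarith) (by nlinarith)
      have hs := mul_le_mul_of_nonneg_left (harm_split ha hb hη hη2) (pow_nonneg hr0 T)
      rw [pow_succ]
      nlinarith
    -- A row already revealed: its answer is certain, so the laws, the weights and the budget `T`
    -- all stay the same.
    · obtain ⟨h3, h4⟩ := h2 i hi
      have hupd : ∀ v, p₀ i = v → Function.update p₀ i v = p₀ ∧ Function.update p₁ i v = p₁ := by
        intro v hv
        refine ⟨?_, ?_⟩
        · rw [← hv, Function.update_eq_self]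
        · rw [← hv, ← h4, Function.update_eq_self]
      rcases h3 with h3 | h3
      · rw [bernExp_run_query, bernExp_run_query, h4, h3, (hupd 0 h3).1, (hupd 0 h3).2]
        have := ih 0 T R p₀ p₁ h1 h2 hk (fun y hy => by
          have := hN y hy
          simp only [numQueries, labels_eq_zero ((hy i).2 h3)] at this
          omega) a b ha hb
        simpa using this
      · rw [bernExp_run_query, bernExp_run_query, h4, h3, (hupd 1 h3).1, (hupd 1 h3).2]
        have := ih 1 T R p₀ p₁ h1 h2 hk (fun y hy => by
          have := hN y hy
          simp only [numQueries, labels_eq_one ((hy i).1 h3)] at this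
          omega) a b ha hb
        simpa using this

/-- Two-point lower bound with constant failure probability, in terms of the expected number of
queries to the rows on which `p₀` and `p₁` differ. -/
theorem QueryTree.two_point_le {n d : ℕ} {η l : ℝ} (hη : 0 ≤ η) (hη2 : η < 1 / 2) (hl : 0 < l)
    (S : Finset (Fin n)) (F₀ F₁ : (Fin d → ℝ) → ℝ)
    (hF : ∀ b, F₀ b + F₁ b = 1) (hF01 : ∀ b, F₀ b = 0 ∨ F₁ b = 0)
    (t : QueryTree n d) : ∀ (p₀ p₁ : Fin n → ℝ),
      (∀ i, (p₀ i ∈ Set.Icc (0 : ℝ) 1 ∧ p₁ i = p₀ i) ∨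
        (i ∈ S ∧ p₀ i = 1 / 2 + η ∧ p₁ i = 1 / 2 - η)) →
      ∀ a b : ℝ, 0 ≤ a → 0 ≤ b →
      (1 / 2 - l / 4 - 1 / (4 * l)) * (a + b) + harm a b / l
        ≤ a * bernExp p₀ (fun y => F₀ (t.run (labels y)))
          + b * bernExp p₁ (fun y => F₁ (t.run (labels y)))
          + η ^ 2 / l * (a * bernExp p₀ (fun y => (t.numQueriesIn S (labels y) : ℝ))
            + b * bernExp p₁ (fun y => (t.numQueriesIn S (labels y) : ℝ))) := by
  induction t with
  | output β =>
    intro p₀ p₁ hp a b ha hb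
    simp only [run, numQueriesIn, bernExp_const, Nat.cast_zero, mul_zero, add_zero]
    -- Here `c` is the weight of the hypothesis that the leaf gets wrong. The gap between the two
    -- sides is a perfect square: `c` is bounded below by a line in the potential, with `l` a free
    -- parameter.
    have key : ∀ c : ℝ, 0 ≤ c → c ≤ a + b → harm a b * (a + b) = c * (a + b - c) →
        (1 / 2 - l / 4 - 1 / (4 * l)) * (a + b) + harm a b / l ≤ c := by
      intro c hc hca hh
      rcases (add_nonneg ha hb).eq_or_lt with h | h
      · have h1 : a = 0 := by linarith
        have h2 : b = 0 := by linarith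
        have : c = 0 := by linarith
        simp [h1, h2, harm, this]
      · have h2 : harm a b = c * (a + b - c) / (a + b) := by rw [eq_div_iff h.ne', hh]
        have : c - ((1 / 2 - l / 4 - 1 / (4 * l)) * (a + b) + harm a b / l)
            = (l * (a + b) + 2 * c - (a + b)) ^ 2 / (4 * l * (a + b)) := by
          rw [h2]; field_simp; ring
        have h3 : 0 ≤ (l * (a + b) + 2 * c - (a + b)) ^ 2 / (4 * l * (a + b)) := by positivity
        linarith
    have hab : harm a b * (a + b) = a * b := by
      rcases (add_nonneg ha hb).eq_or_lt with h | h
      · have h1 : a = 0 := by linarith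
        simp [h1, harm]
      · unfold harm; field_simp
    rcases hF01 β with h | h
    · have h' : F₁ β = 1 := by linarith [hF β]
      rw [h, h']
      linarith [key b hb (by linarith) (by rw [hab]; ring)]
    · have h' : F₀ β = 1 := by linarith [hF β]
      rw [h, h']
      linarith [key a ha (by linarith) (by rw [hab]; ring)]
  | query i next ih =>
    intro p₀ p₁ hp a b ha hb
    have step : ∀ v : ℝ, v ∈ Set.Icc (0 : ℝ) 1 → ∀ a b : ℝ, 0 ≤ a → 0 ≤ b → _ :=
      fun v hv => ih v (Function.update p₀ i v) (Function.update p₁ i v) (fun k => by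
        by_cases hk : k = i
        · subst hk; left; simpa using hv
        · simpa [hk] using hp k)
    rw [bernExp_run_query p₀ i next (fun b _ => F₀ b),
      bernExp_run_query p₁ i next (fun b _ => F₁ b),
      bernExp_numQueriesIn_query, bernExp_numQueriesIn_query]
    rcases hp i with ⟨hv, he⟩ | ⟨hi, h3, h4⟩
    · rw [he]
      have s1 := step 1 (by simp) (a * p₀ i) (b * p₀ i) (mul_nonneg ha hv.1) (mul_nonneg hb hv.1)
      have s0 := step 0 (by simp) (a * (1 - p₀ i)) (b * (1 - p₀ i))
        (mul_nonneg ha (by linarith [hv.2])) (mul_nonneg hb (by linarith [hv.2]))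
      rw [harm_mul] at s1 s0
      have hind : 0 ≤ η ^ 2 / l * ((a + b) * if i ∈ S then (1 : ℝ) else 0) := by
        split_ifs <;> positivity
      have hsum : harm a b / l = harm a b * p₀ i / l + harm a b * (1 - p₀ i) / l := by ring
      rw [hsum]
      linarith
    · rw [h3, h4, if_pos hi]
      have s1 := step 1 (by simp) (a * (1 / 2 + η)) (b * (1 / 2 - η))
        (by nlinarith) (by nlinarith)
      have s0 := step 0 (by simp) (a * (1 / 2 - η)) (b * (1 / 2 + η))
        (by nlinarith) (by nlinarith)
      have hs := harm_split ha hb hη hη2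
      have h5 : (harm a b - η ^ 2 * (a + b)) / l ≤ (harm (a * (1 / 2 + η)) (b * (1 / 2 - η))
          + harm (a * (1 / 2 - η)) (b * (1 / 2 + η))) / l := by
        -- The multiplicative loss `4η² * harm a b` is at most `η² (a + b)`, which is exactly what
        -- the query count contributes.
        refine div_le_div_of_nonneg_right (le_trans ?_ hs) hl.le
        nlinarith [four_mul_harm_le ha hb, sq_nonneg η]
      have h6 : (harm a b - η ^ 2 * (a + b)) / l = harm a b / l - η ^ 2 / l * (a + b) := by ring
      rw [h6, add_div] at h5
      linarith

/-- A tree that returns `b₀` when it only sees zeros also returns `b₀`, with probability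
exponentially small in the number of its queries, when the labels are mostly ones. -/
theorem QueryTree.le_bernExp_zero_path {n d : ℕ} (k : ℕ) (S : Finset (Fin n)) (b₀ : Fin d → ℝ)
    (F : (Fin d → ℝ) → (Fin n → Bool) → ℝ) (hF : ∀ b y, 0 ≤ F b y)
    (hleaf : ∀ p : Fin n → ℝ, (∀ i, p i = 0 ∨ (i ∈ S ∧ p i = 3 / 4)) →
      (S.filter fun i => p i = 0).card ≤ k → 1 / 2 ≤ bernExp p (F b₀))
    (t : QueryTree n d) : ∀ p : Fin n → ℝ, (∀ i, p i = 0 ∨ (i ∈ S ∧ p i = 3 / 4)) →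
      (S.filter fun i => p i = 0).card + t.numQueriesIn S 0 ≤ k → t.run 0 = b₀ →
      1 / 2 * (1 / 4) ^ t.numQueriesIn S 0 ≤ bernExp p (fun y => F (t.run (labels y)) y) := by
  induction t with
  | output β =>
    intro p hp hk hb
    simp only [run, numQueriesIn] at *
    subst hb
    simpa using hleaf p hp (by omega)
  | query i next ih =>
    intro p hp hk hb
    have hIcc : ∀ i, p i ∈ Set.Icc (0 : ℝ) 1 := fun i => by
      rcases hp i with h | ⟨-, h⟩ <;> rw [h] <;> norm_num
    rw [bernExp_run_query]
    simp only [run, numQueriesIn, Pi.zero_apply] at hk hb ⊢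
    have e1 : 0 ≤ p i * bernExp (Function.update p i 1)
        (fun y => F ((next 1).run (labels y)) y) :=
      mul_nonneg (hIcc i).1 (bernExp_nonneg (update_mem_Icc hIcc i (by simp)) fun y => hF _ y)
    have hcard : (S.filter fun l => Function.update p i 0 l = 0).card
        ≤ (S.filter fun l => p l = 0).card + if i ∈ S then 1 else 0 := by
      split_ifs with hi
      · refine le_trans (card_le_card (t := insert i (S.filter fun l => p l = 0)) ?_)
          (card_insert_le _ _)
        intro l
        by_cases hl : l = i <;> simp [hl]
      · refine card_le_card fun l hl => ?_
        rw [mem_filter] at hl ⊢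
        have : l ≠ i := fun h => hi (h ▸ hl.1)
        simpa [this] using hl
    have e0 := ih 0 (Function.update p i 0) (fun l => by
      by_cases hl : l = i
      · subst hl; simp
      · simpa [hl] using hp l) (by omega) hb
    have hpow : (0 : ℝ) < (1 / 4) ^ (next 0).numQueriesIn S 0 := by positivity
    -- If `p i = 0`, the answer zero is certain; otherwise it has probability `1/4`, the factor paid
    -- for this query.
    rcases hp i with h | ⟨hi, h⟩
    · rw [h] at e1 ⊢
      have : ((1 : ℝ) / 4) ^ ((next 0).numQueriesIn S 0 + if i ∈ S then 1 else 0)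
          ≤ (1 / 4) ^ (next 0).numQueriesIn S 0 :=
        pow_le_pow_of_le_one (by norm_num) (by norm_num) (by omega)
      linarith
    · rw [h] at e1 ⊢
      rw [if_pos hi, pow_succ]
      linarith

/-! ### Regression with cluster matrices -/

/-- The matrix whose `i`-th row is the standard basis vector `e_{g i}`. -/
def clusterMatrix {n d : ℕ} (g : Fin n → Fin d) : Matrix (Fin n) (Fin d) ℝ :=
  fun i j => if g i = j then 1 else 0

lemma l1Loss_clusterMatrix {n d : ℕ} (g : Fin n → Fin d) (y : Fin n → ℝ) (β : Fin d → ℝ) :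
    l1Loss (clusterMatrix g) y β = ∑ i, |β (g i) - y i| := by
  simp [l1Loss, Matrix.mulVec, dotProduct, clusterMatrix]

/-- The distance of `x ∈ [0, 1]` to the bit `s`. -/
def mism (s : Bool) (x : ℝ) : ℝ := if s then 1 - x else x

/-- The projection of a real number to `[0, 1]`. -/
noncomputable def clamp (x : ℝ) : ℝ := max 0 (min x 1)

/-- Whether `x` rounds to the wrong bit, as a number. -/
noncomputable def wrong (s : Bool) (x : ℝ) : ℝ := if decide (x < 1 / 2) = s then 1 else 0

lemma mism_clamp_mem (s : Bool) (x : ℝ) : mism s (clamp x) ∈ Set.Icc (0 : ℝ) 1 := by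
  have h1 : 0 ≤ clamp x := le_max_left _ _
  have h2 : clamp x ≤ 1 := max_le (by norm_num) (min_le_right _ _)
  cases s <;> simp [mism, h1, h2]

lemma wrong_le (s : Bool) (x : ℝ) : wrong s x ≤ 2 * mism s (clamp x) := by
  have h := mism_clamp_mem s x
  unfold wrong
  split_ifs with hw
  · subst hw
    by_cases hx : x < 1 / 2
    · have : clamp x ≤ 1 / 2 := max_le (by norm_num) ((min_le_left _ _).trans hx.le)
      simp only [mism, hx, decide_true, if_true]
      linarith
    · have : 1 / 2 ≤ clamp x := le_max_of_le_right (le_min (not_lt.1 hx) (by norm_num))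
      simp only [mism, hx, decide_false]
      simp
      linarith
  · linarith [h.1]

lemma abs_bit_sub_bit (s c : Bool) : |bit s - bit c| = mism s (bit c) := by
  cases s <;> cases c <;> simp [mism, bit]

/-- For `x` in `[0, 1]` this is an equality, as the distance to a bit is affine there; clamping only
decreases the distance to a bit. -/
lemma mism_clamp_mul_le (s c : Bool) (x : ℝ) :
    mism s (bit c) + mism s (clamp x) * (1 - 2 * mism s (bit c)) ≤ |x - bit c| := by
  have h1 : clamp x ≤ |x| := max_le (abs_nonneg x) ((min_le_left _ _).trans (le_abs_self x))
  have h2 : 1 - clamp x ≤ |x - 1| := by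
    rcases le_total x 1 with h | h
    · have : x ≤ clamp x := le_max_of_le_right (le_min le_rfl h)
      rw [abs_sub_comm]
      exact le_trans (by linarith) (le_abs_self _)
    · have : 1 ≤ clamp x := le_max_of_le_right (le_min h le_rfl)
      exact le_trans (by linarith) (abs_nonneg _)
  cases s <;> cases c <;> simp [mism, bit] <;> linarith

lemma l1Loss_bits {n d : ℕ} (g : Fin n → Fin d) (y : Fin n → Bool) (σ : Fin d → Bool) :
    l1Loss (clusterMatrix g) (labels y) (fun j => bit (σ j))
      = ∑ i, mism (σ (g i)) (bit (y i)) := by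
  rw [l1Loss_clusterMatrix]
  exact sum_congr rfl fun i _ => abs_bit_sub_bit _ _

/-- The first sum is the loss of the rounded competitor `σ`, so the second is a lower bound for the
excess loss of `b` over it. -/
lemma le_l1Loss {n d : ℕ} (g : Fin n → Fin d) (y : Fin n → Bool) (σ : Fin d → Bool)
    (b : Fin d → ℝ) :
    ∑ i, mism (σ (g i)) (bit (y i)) + ∑ i, mism (σ (g i)) (clamp (b (g i))) *
      (1 - 2 * mism (σ (g i)) (bit (y i))) ≤ l1Loss (clusterMatrix g) (labels y) b := by
  rw [l1Loss_clusterMatrix, ← sum_add_distrib]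
  exact sum_le_sum fun i _ => mism_clamp_mul_le _ _ _

lemma sum_mism_eq {ι : Type*} (s : Finset ι) (c : Bool) (x p : ι → ℝ) :
    ∑ i ∈ s, mism c (x i) = ∑ i ∈ s, mism c (p i) + (1 - 2 * bit c) * ∑ i ∈ s, (x i - p i) := by
  rw [mul_sum, ← sum_add_distrib]
  refine sum_congr rfl fun i _ => ?_
  cases c <;> simp [mism, bit]
  ring

lemma abs_one_sub_two_bit (c : Bool) : |1 - 2 * bit c| = 1 := by
  cases c <;> norm_num [bit]

/-! ### One cluster: small failure probability -/

/-- The slack `ε n / 4` in `hmean` absorbs revealed rows, and Chebyshev adds as much again. So with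
probability at least `1/2` the constant `s` has loss below `n (1/2 - 3ε/2)`, while an output on the
wrong side of `1/2` has loss at least `n/2`. -/
lemma half_le_bernExp_failInd {n d : ℕ} (j : Fin d) {ε : ℝ} (hε : 0 < ε) (hε1 : ε < 1 / 10)
    (hn : 8 ≤ ε ^ 2 * n) {p : Fin n → ℝ} (hp : ∀ i, p i ∈ Set.Icc (0 : ℝ) 1) (s : Bool)
    (hmean : ∑ i, mism s (p i) ≤ n * (1 / 2 - 2 * ε) + ε * n / 4) (b : Fin d → ℝ)
    (hb : 1 / 2 ≤ mism s (clamp (b j))) :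
    1 / 2 ≤ bernExp p (fun y => failInd (clusterMatrix fun _ : Fin n => j) ε b (labels y)) := by
  have hn0 : (0 : ℝ) < n := by
    by_contra h
    nlinarith [sq_nonneg ε]
  have h := le_bernExp_of_close hp univ (t := ε * n / 4) (by positivity)
    (f := fun y => failInd (clusterMatrix fun _ : Fin n => j) ε b (labels y))
    (fun y => failInd_nonneg _ _ _ _) (fun y _ hy => by
      refine (failInd_eq_one (fun _ => bit s) ?_).ge
      refine lt_of_lt_of_le ?_ (le_l1Loss _ y (fun _ => s) b)
      rw [l1Loss_bits _ y (fun _ => s)]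
      simp only [← mul_sum, sum_sub_distrib, sum_const, card_univ, Fintype.card_fin, nsmul_eq_mul]
      have hM := sum_mism_eq univ s (fun i => bit (y i)) p
      have hle : (1 - 2 * bit s) * ∑ i, (bit (y i) - p i) < ε * n / 4 := by
        refine lt_of_le_of_lt (le_abs_self _) ?_
        rw [abs_mul, abs_one_sub_two_bit, one_mul]
        exact hy
      have hM2 : ∑ i, mism s (bit (y i)) < n * (1 / 2 - 2 * ε) + ε * n / 4 + ε * n / 4 := by
        linarith
      set M := ∑ i, mism s (bit (y i))
      have hεn : 0 < ε * n := by positivity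
      have h3 : 0 < n * 1 - 2 * M := by nlinarith
      nlinarith [mul_le_mul_of_nonneg_right hb h3.le, mul_lt_mul_of_pos_left hM2 hε])
  refine le_trans ?_ h
  rw [card_univ, Fintype.card_fin]
  have : (n : ℝ) / (4 * (ε * n / 4) ^ 2) = 4 / (ε ^ 2 * n) := by field_simp
  rw [this]
  have : 4 / (ε ^ 2 * n) ≤ 1 / 2 := by
    rw [div_le_div_iff₀ (by positivity) (by norm_num)]
    linarith
  linarith

lemma exp_neg_two_mul_le {x : ℝ} (h0 : 0 ≤ x) (h1 : x ≤ 1 / 2) : Real.exp (-(2 * x)) ≤ 1 - x := by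
  rw [Real.exp_neg]
  have h2 := Real.add_one_le_exp (2 * x)
  rw [inv_le_comm₀ (Real.exp_pos _) (by linarith)]
  refine le_trans ?_ h2
  rw [inv_le_iff_one_le_mul₀ (by linarith)]
  nlinarith

lemma exp_half_log_sq {δ : ℝ} (hδ : 0 < δ) : Real.exp (-(Real.log (1 / δ) / 2)) ^ 2 = δ := by
  rw [← Real.exp_nat_mul]
  push_cast
  rw [show (2 : ℝ) * -(Real.log (1 / δ) / 2) = -Real.log (1 / δ) by ring, one_div, Real.log_inv,
    neg_neg, Real.exp_log hδ]

theorem one_cluster_lower_bound {n d : ℕ} (j : Fin d) {ε δ T : ℝ} (hε : 0 < ε) (hε1 : ε < 1 / 10)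
    (hδ : 0 < δ) (hδ1 : δ < 1 / 64) (hT0 : T ≤ Real.log (1 / δ) / (64 * ε ^ 2))
    (hn : 8 ≤ ε ^ 2 * n) (hnT : 4 * T ≤ ε * n) (L : RandomizedLearner.{u} n d)
    (hsolve : ∀ y : Fin n → ℝ, 1 - δ ≤ L.law.real {ω | ∀ β : Fin d → ℝ,
      l1Loss (clusterMatrix fun _ => j) y ((L.tree ω).run y)
        ≤ (1 + ε) * l1Loss (clusterMatrix fun _ => j) y β})
    (hT : ∀ y : Fin n → ℝ, L.law {ω | T ≤ ((L.tree ω).numQueries y : ℝ)} = 0) : False := by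
  obtain ⟨t, htT, ht⟩ := L.exists_tree (clusterMatrix fun _ => j) ε δ T hsolve hT
    (fun _ : Bool => (1 / 2 : ℝ)) (fun _ => by norm_num) (by simp)
    (fun s _ => if s then 1 / 2 + 2 * ε else 1 / 2 - 2 * ε)
    (fun s i => by cases s <;> simp <;> constructor <;> linarith)
  have hT1 : 0 ≤ T := le_trans (Nat.cast_nonneg _) (htT fun _ => false).le
  have hkT : (⌊T⌋₊ : ℝ) ≤ T := Nat.floor_le hT1
  have hlow := QueryTree.pow_mul_harm_le (η := 2 * ε) (by linarith) (by linarith) ⌊T⌋₊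
    (fun b y => failInd (clusterMatrix fun _ : Fin n => j) ε b (labels y))
    (fun b y => failInd_nonneg _ _ _ _) (by
      intro R p₀ p₁ h1 h2 hR b
      -- At most `T ≤ ε n / 4` rows have been revealed, which is the slack allowed in the mean.
      have hRk : ((Rᶜ.card : ℕ) : ℝ) ≤ ε * n / 4 := by
        have : ((Rᶜ.card : ℕ) : ℝ) ≤ ⌊T⌋₊ := by exact_mod_cast hR
        linarith
      have hmean : ∀ (s : Bool) (p : Fin n → ℝ), (∀ i, mism s (p i) ≤ 1) →
          (∀ i ∈ R, mism s (p i) = 1 / 2 - 2 * ε) →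
          ∑ i, mism s (p i) ≤ n * (1 / 2 - 2 * ε) + ε * n / 4 := by
        intro s p hp1 hpR
        rw [← sum_add_sum_compl R, sum_congr rfl hpR]
        have e1 : ∑ i ∈ Rᶜ, mism s (p i) ≤ Rᶜ.card := by
          simpa using sum_le_sum (s := Rᶜ) fun i _ => hp1 i
        have e2 : (R.card : ℝ) ≤ n := by
          exact_mod_cast (card_le_univ R).trans (by simp)
        rw [sum_const, nsmul_eq_mul]
        have : (R.card : ℝ) * (1 / 2 - 2 * ε) ≤ n * (1 / 2 - 2 * ε) :=
          mul_le_mul_of_nonneg_right e2 (by linarith)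
        linarith
      have hp0 : ∀ i, p₀ i ∈ Set.Icc (0 : ℝ) 1 := fun i => by
        by_cases hi : i ∈ R
        · rw [(h1 i hi).1]; constructor <;> linarith
        · rcases (h2 i hi).1 with h | h <;> rw [h] <;> norm_num
      have hp1 : ∀ i, p₁ i ∈ Set.Icc (0 : ℝ) 1 := fun i => by
        by_cases hi : i ∈ R
        · rw [(h1 i hi).2]; constructor <;> linarith
        · rw [(h2 i hi).2]; exact hp0 i
      by_cases hb : b j < 1 / 2
      · left
        refine half_le_bernExp_failInd j hε hε1 hn hp0 true (hmean true p₀ ?_ ?_) b ?_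
        · intro i; simpa [mism] using (hp0 i).1
        · intro i hi; simp only [mism, if_true, (h1 i hi).1]; ring
        · have := wrong_le true (b j)
          simp only [wrong, hb, decide_true, if_true] at this
          linarith
      · right
        refine half_le_bernExp_failInd j hε hε1 hn hp1 false (hmean false p₁ ?_ ?_) b ?_
        · intro i; simpa [mism] using (hp1 i).2
        · intro i hi; simp [mism, (h1 i hi).2]
        · have := wrong_le false (b j)
          simp only [wrong, hb, decide_false, if_true] at this
          linarith)
    t ⌊T⌋₊ univ (fun _ => 1 / 2 + 2 * ε) (fun _ => 1 / 2 - 2 * ε) (by simp) (by simp) (by simp)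
    (fun y _ => Nat.le_floor (htT y).le) (1 / 2) (1 / 2) (by norm_num) (by norm_num)
  rw [Fintype.sum_bool] at ht
  simp only [if_true, Bool.false_eq_true, if_false] at ht
  have h1 := hlow.trans ht
  have hharm : harm (1 / 2) (1 / 2) = 1 / 4 := by norm_num [harm]
  rw [hharm] at h1
  set s := Real.exp (-(Real.log (1 / δ) / 2))
  have hs2 : s ^ 2 = δ := exp_half_log_sq hδ
  have hs0 : 0 < s := Real.exp_pos _
  have hpow : s ≤ (1 - 4 * (2 * ε) ^ 2) ^ ⌊T⌋₊ := by
    calc s ≤ Real.exp (-(2 * (4 * (2 * ε) ^ 2))) ^ ⌊T⌋₊ := by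
          rw [← Real.exp_nat_mul]
          refine Real.exp_le_exp.2 ?_
          rw [le_div_iff₀ (by positivity)] at hT0
          have : (⌊T⌋₊ : ℝ) * (64 * ε ^ 2) ≤ T * (64 * ε ^ 2) :=
            mul_le_mul_of_nonneg_right hkT (by positivity)
          nlinarith
      _ ≤ _ := pow_le_pow_left₀ (Real.exp_pos _).le
          (exp_neg_two_mul_le (by positivity) (by nlinarith)) _
  -- With `s = √δ` the bounds read `s / 8 ≤ s²`, forcing `δ ≥ 1/64`.
  nlinarith

/-! ### Many clusters: constant failure probability -/

/-- Flipping the sign at `j` is an involution, which pairs the two hypotheses about cluster `j` with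
all other signs fixed. -/
lemma sum_eq_half_sum_update {κ : Type*} [Fintype κ] [DecidableEq κ] (j : κ)
    (f : (κ → Bool) → ℝ) :
    ∑ σ, f σ = ∑ σ, (1 / 2 * f (Function.update σ j true)
      + 1 / 2 * f (Function.update σ j false)) := by
  have hinv : Function.Involutive fun σ : κ → Bool => Function.update σ j (!σ j) := by
    intro σ; simp
  have h1 : ∑ σ, f (Function.update σ j (!σ j)) = ∑ σ, f σ :=
    Equiv.sum_comp hinv.toPerm f
  have h2 : ∑ σ, f σ = ∑ σ, (1 / 2 * f σ + 1 / 2 * f (Function.update σ j (!σ j))) := by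
    rw [sum_add_distrib, ← mul_sum, ← mul_sum, h1]; ring
  rw [h2]
  refine sum_congr rfl fun σ _ => ?_
  have h3 : σ = Function.update σ j (σ j) := (Function.update_eq_self j σ).symm
  cases hσ : σ j
  · rw [hσ] at h3; rw [← h3]; simp [add_comm]
  · rw [hσ] at h3; rw [← h3]; simp

/-- If more than `d/4` signs are wrong, the excess loss is at least `ε d m` up to twice the total
deviation `∑ |D j|`. So either `b` fails, or that deviation is at least `ε d m / 8`, and then
Cauchy–Schwarz makes the quadratic term at least `1`. In both cases the trivial bound `d` suffices.
-/
lemma wrong_sum_le {n d m : ℕ} (g : Fin n → Fin d)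
    (hg : ∀ j, (univ.filter fun i => g i = j).card = m) {ε : ℝ} (hε : 0 < ε)
    (hd : 0 < d) (hm : 0 < m) (σ : Fin d → Bool) (y : Fin n → Bool) (b : Fin d → ℝ)
    (p : Fin n → ℝ) (hp : ∀ i, mism (σ (g i)) (p i) = 1 / 2 - 4 * ε) :
    ∑ j, wrong (σ j) (b j) ≤ d / 4 + 3 * d / 4 * (failInd (clusterMatrix g) ε b (labels y)
      + 64 / (ε ^ 2 * d * m ^ 2) * ∑ j, (∑ i with g i = j, (bit (y i) - p i)) ^ 2) := by
  have hd' : (0 : ℝ) < d := by exact_mod_cast hd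
  have hm' : (0 : ℝ) < m := by exact_mod_cast hm
  set D : Fin d → ℝ := fun j => ∑ i with g i = j, (bit (y i) - p i) with hD
  have hw1 : ∑ j, wrong (σ j) (b j) ≤ d := by
    have : ∀ j ∈ univ, wrong (σ j) (b j) ≤ 1 := fun j _ => by
      unfold wrong; split_ifs <;> norm_num
    simpa using sum_le_sum this
  have hf0 := failInd_nonneg (clusterMatrix g) ε b (labels y)
  have hQ0 : 0 ≤ ∑ j, D j ^ 2 := sum_nonneg fun j _ => sq_nonneg _
  have hc0 : 0 ≤ 64 / (ε ^ 2 * d * m ^ 2) * ∑ j, D j ^ 2 := by positivity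
  by_cases hw : ∑ j, wrong (σ j) (b j) ≤ d / 4
  · refine hw.trans (le_add_of_nonneg_right ?_)
    positivity
  suffices h : 1 ≤ failInd (clusterMatrix g) ε b (labels y)
      + 64 / (ε ^ 2 * d * m ^ 2) * ∑ j, D j ^ 2 by
    nlinarith
  by_cases hDs : ε * (d * m) / 8 ≤ ∑ j, |D j|
  · have h1 : (∑ j, |D j|) ^ 2 ≤ d * ∑ j, D j ^ 2 := by
      simpa using sq_sum_le_card_mul_sum_sq (s := univ) (f := fun j => |D j|)
    have h2 : (ε * (d * m) / 8) ^ 2 ≤ (∑ j, |D j|) ^ 2 :=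
      pow_le_pow_left₀ (by positivity) hDs 2
    have h3 : 1 ≤ 64 / (ε ^ 2 * d * m ^ 2) * ∑ j, D j ^ 2 := by
      rw [div_mul_eq_mul_div, one_le_div (by positivity)]
      have h4 := h2.trans h1
      have h5 : d * (ε ^ 2 * d * m ^ 2) ≤ d * (64 * ∑ j, D j ^ 2) := by nlinarith
      exact le_of_mul_le_mul_left h5 hd'
    linarith
  · have hDs' := not_le.1 hDs
    refine le_add_of_le_of_nonneg (failInd_eq_one (fun j => bit (σ j)) ?_).ge hc0
    refine lt_of_lt_of_le ?_ (le_l1Loss g y σ b)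
    rw [l1Loss_bits]
    have hM : ∀ j, ∑ i with g i = j, mism (σ (g i)) (bit (y i))
        = m * (1 / 2 - 4 * ε) + (1 - 2 * bit (σ j)) * D j := by
      intro j
      have e1 : ∑ i with g i = j, mism (σ (g i)) (bit (y i))
          = ∑ i with g i = j, mism (σ j) (bit (y i)) :=
        sum_congr rfl fun i hi => by rw [(mem_filter.1 hi).2]
      have e2 : ∑ i with g i = j, mism (σ j) (p i) = ∑ i with g i = j, (1 / 2 - 4 * ε) :=
        sum_congr rfl fun i hi => by rw [← hp i, (mem_filter.1 hi).2]
      rw [e1, sum_mism_eq _ _ _ p, e2, sum_const, hg, nsmul_eq_mul]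
    have hcD : ∀ j, |(1 - 2 * bit (σ j)) * D j| = |D j| := fun j => by
      rw [abs_mul, abs_one_sub_two_bit, one_mul]
    have hMle : ∑ i, mism (σ (g i)) (bit (y i)) ≤ d * m * (1 / 2 - 4 * ε) + ∑ j, |D j| := by
      rw [← sum_fiberwise univ g]
      calc _ ≤ ∑ j : Fin d, (m * (1 / 2 - 4 * ε) + |D j|) := by
            refine sum_le_sum fun j _ => ?_
            rw [hM, ← hcD]
            linarith [le_abs_self ((1 - 2 * bit (σ j)) * D j)]
        _ = _ := by simp [sum_add_distrib]; ring
    have hgain : 4 * ε * m * ∑ j, wrong (σ j) (b j) - 2 * ∑ j, |D j| ≤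
        ∑ i, mism (σ (g i)) (clamp (b (g i))) * (1 - 2 * mism (σ (g i)) (bit (y i))) := by
      rw [← sum_fiberwise univ g (fun i => mism (σ (g i)) (clamp (b (g i))) *
        (1 - 2 * mism (σ (g i)) (bit (y i)))), mul_sum, mul_sum, ← sum_sub_distrib]
      refine sum_le_sum fun j _ => ?_
      have e1 : ∑ i with g i = j, mism (σ (g i)) (clamp (b (g i))) *
          (1 - 2 * mism (σ (g i)) (bit (y i))) = mism (σ j) (clamp (b j)) *
            (m - 2 * ∑ i with g i = j, mism (σ (g i)) (bit (y i))) := by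
        have : (m : ℝ) = ∑ i with g i = j, (1 : ℝ) := by simp [hg]
        rw [this, mul_sum, ← sum_sub_distrib, mul_sum]
        exact sum_congr rfl fun i hi => by rw [(mem_filter.1 hi).2]
      rw [e1, hM]
      have hc := mism_clamp_mem (σ j) (b j)
      have hwj := wrong_le (σ j) (b j)
      have h1 := le_abs_self ((1 - 2 * bit (σ j)) * D j)
      rw [hcD] at h1
      have h2 : 0 ≤ ε * m := by positivity
      have h3 := mul_le_mul_of_nonneg_left h1 hc.1
      have h4 := mul_le_of_le_one_left (abs_nonneg (D j)) hc.2
      nlinarith [mul_le_mul_of_nonneg_left hwj h2]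
    have hw' := not_le.1 hw
    have hdm : 0 < ε * (d * m) := by positivity
    have h5 : 4 * ε * m * (d / 4) < 4 * ε * m * ∑ j, wrong (σ j) (b j) :=
      mul_lt_mul_of_pos_left hw' (by positivity)
    have h6 := mul_le_mul_of_nonneg_left hMle hε.le
    have h7 := mul_lt_mul_of_pos_left hDs' hε
    nlinarith

theorem many_clusters_lower_bound {n d m : ℕ} (g : Fin n → Fin d)
    (hg : ∀ j, (univ.filter fun i => g i = j).card = m) (hd : 0 < d) {ε δ T : ℝ} (hε : 0 < ε)
    (hε1 : ε < 1 / 10) (hδ1 : δ < 1 / 4) (hT0 : T ≤ d / (2 ^ 14 * ε ^ 2))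
    (hm : 384 ≤ ε ^ 2 * m) (L : RandomizedLearner.{u} n d)
    (hsolve : ∀ y : Fin n → ℝ, 1 - δ ≤ L.law.real {ω | ∀ β : Fin d → ℝ,
      l1Loss (clusterMatrix g) y ((L.tree ω).run y) ≤ (1 + ε) * l1Loss (clusterMatrix g) y β})
    (hT : ∀ y : Fin n → ℝ, L.law {ω | T ≤ ((L.tree ω).numQueries y : ℝ)} = 0) : False := by
  have hd' : (0 : ℝ) < d := by exact_mod_cast hd
  have hm' : (0 : ℝ) < m := by
    by_contra h
    nlinarith [sq_nonneg ε]
  set p : (Fin d → Bool) → Fin n → ℝ :=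
    fun σ i => if σ (g i) then 1 / 2 + 4 * ε else 1 / 2 - 4 * ε with hpdef
  have hp : ∀ σ i, p σ i ∈ Set.Icc (0 : ℝ) 1 := fun σ i => by
    simp only [hpdef]; split_ifs <;> constructor <;> linarith
  have hpm : ∀ σ i, mism (σ (g i)) (p σ i) = 1 / 2 - 4 * ε := fun σ i => by
    cases h : σ (g i) <;> simp [hpdef, mism, h]; ring
  obtain ⟨t, htT, ht⟩ := L.exists_tree (clusterMatrix g) ε δ T hsolve hT
    (fun _ : Fin d → Bool => (1 / 2 : ℝ) ^ d) (fun _ => by positivity) (by simp) p hp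
  have hpair : ∀ j, (2 : ℝ) ^ d * (1 / 2 - 1 / 64) ≤
      ∑ σ, (bernExp (p σ) (fun y => wrong (σ j) (t.run (labels y) j))
        + 256 * ε ^ 2 * bernExp (p σ)
          (fun y => (t.numQueriesIn {i | g i = j} (labels y) : ℝ))) := by
    intro j
    rw [sum_eq_half_sum_update j]
    refine le_trans (b := ∑ σ : Fin d → Bool, (1 / 2 - 1 / 64 : ℝ)) (le_of_eq (by simp; ring))
      (sum_le_sum fun σ _ => ?_)
    -- With `a = b = 1/2` the lower bound is `1/2 - l/4`; `l = 1/16` gives `1/2 - 1/64` at the price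
    -- `(4ε)²/l = 256 ε²` per query.
    have h := QueryTree.two_point_le (η := 4 * ε) (l := 1 / 16) (by linarith) (by linarith)
      (by norm_num) {i | g i = j} (fun b => wrong true (b j)) (fun b => wrong false (b j))
      (fun b => by by_cases hb : b j < 1 / 2 <;> simp only [wrong, hb] <;> simp)
      (fun b => by by_cases hb : b j < 1 / 2 <;> simp only [wrong, hb] <;> simp)
      t (p (Function.update σ j true)) (p (Function.update σ j false))
      (fun i => by
        by_cases hi : g i = j
        · right; simp [hpdef, hi]
        · left; exact ⟨hp _ _, by simp [hpdef, hi]⟩)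
      (1 / 2) (1 / 2) (by norm_num) (by norm_num)
    have hharm : harm (1 / 2) (1 / 2) = 1 / 4 := by norm_num [harm]
    rw [hharm] at h
    have h' := le_trans (b := _) (a := (1 / 2 - 1 / 64 : ℝ)) (by norm_num) h
    refine h'.trans (le_of_eq ?_)
    rw [Function.update_self, Function.update_self]
    ring
  have hsum := sum_le_sum fun j (_ : j ∈ (univ : Finset (Fin d))) => hpair j
  rw [sum_comm] at hsum
  have hupper : ∀ σ ∈ (univ : Finset (Fin d → Bool)),
      ∑ j, (bernExp (p σ) (fun y => wrong (σ j) (t.run (labels y) j))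
        + 256 * ε ^ 2 * bernExp (p σ) (fun y => (t.numQueriesIn {i | g i = j} (labels y) : ℝ)))
      ≤ d / 4 + 3 * d / 4 * (bernExp (p σ)
        (fun y => failInd (clusterMatrix g) ε (t.run (labels y)) (labels y)) + 1 / 24) + d / 64 := by
    intro σ _
    rw [sum_add_distrib, ← mul_sum, ← bernExp_sum, ← bernExp_sum]
    have hN : bernExp (p σ)
        (fun y => ∑ j, (t.numQueriesIn {i | g i = j} (labels y) : ℝ)) ≤ T := by
      rw [← bernExp_const (p σ) T]
      refine bernExp_mono (hp σ) fun y _ => ?_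
      have := t.sum_numQueriesIn g (labels y)
      have h2 : ∑ j, (t.numQueriesIn {i | g i = j} (labels y) : ℝ) = t.numQueries (labels y) := by
        exact_mod_cast this
      rw [h2]; exact (htT y).le
    have hN2 : 256 * ε ^ 2 * bernExp (p σ)
        (fun y => ∑ j, (t.numQueriesIn {i | g i = j} (labels y) : ℝ)) ≤ d / 64 := by
      rw [le_div_iff₀ (by positivity)] at hT0
      nlinarith [mul_le_mul_of_nonneg_left hN (sq_nonneg ε)]
    have hW := bernExp_mono (hp σ) (fun y _ => wrong_sum_le g hg hε hd
      (by exact_mod_cast hm') σ y (t.run (labels y)) (p σ) (hpm σ))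
    simp only [bernExp_add, bernExp_const_mul, bernExp_const] at hW
    have hV : 64 / (ε ^ 2 * d * m ^ 2) * bernExp (p σ)
        (fun y => ∑ j, (∑ i with g i = j, (bit (y i) - p σ i)) ^ 2) ≤ 1 / 24 := by
      rw [bernExp_sum]
      have h1 : ∑ j, bernExp (p σ) (fun y => (∑ i with g i = j, (bit (y i) - p σ i)) ^ 2)
          ≤ ∑ j : Fin d, (m / 4 : ℝ) := by
        refine sum_le_sum fun j _ => ?_
        have := bernExp_sq_le (p σ) {i | g i = j}
        rwa [hg j] at this
      rw [sum_const, card_univ, Fintype.card_fin, nsmul_eq_mul] at h1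
      refine (mul_le_mul_of_nonneg_left h1 (by positivity)).trans ?_
      have : 64 / (ε ^ 2 * d * m ^ 2) * (d * (m / 4)) = 16 / (ε ^ 2 * m) := by
        field_simp; norm_num
      rw [this, div_le_div_iff₀ (by positivity) (by norm_num)]
      linarith
    have h3 : 3 * d / 4 * (bernExp (p σ)
        (fun y => failInd (clusterMatrix g) ε (t.run (labels y)) (labels y)) +
        64 / (ε ^ 2 * d * m ^ 2) * bernExp (p σ)
        (fun y => ∑ j, (∑ i with g i = j, (bit (y i) - p σ i)) ^ 2)) ≤
        3 * d / 4 * (bernExp (p σ)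
        (fun y => failInd (clusterMatrix g) ε (t.run (labels y)) (labels y)) + 1 / 24) :=
      mul_le_mul_of_nonneg_left (by linarith) (by positivity)
    linarith
  have hfin := hsum.trans (sum_le_sum hupper)
  simp only [sum_add_distrib, ← mul_sum, sum_const, card_univ, Fintype.card_fin,
    Fintype.card_pi, Fintype.card_bool, prod_const, nsmul_eq_mul] at hfin ht
  push_cast at hfin
  set E := ∑ σ, bernExp (p σ)
    (fun y => failInd (clusterMatrix g) ε (t.run (labels y)) (labels y))
  have h2d : (0 : ℝ) < 2 ^ d := by positivity
  have hE : E < 2 ^ d * (1 / 4) := by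
    have h3 : (1 / 2 : ℝ) ^ d * E < 1 / 4 := lt_of_le_of_lt ht hδ1
    have h4 := mul_lt_mul_of_pos_left h3 h2d
    rwa [← mul_assoc, ← mul_pow, mul_one_div_cancel two_ne_zero, one_pow, one_mul] at h4
  have h8 : 0 < 2 ^ d * (d : ℝ) := by positivity
  have h9 := mul_lt_mul_of_pos_left hE (show 0 < 3 * (d : ℝ) / 4 by positivity)
  -- The constants just meet: `1/2 - 1/64 = 1/4 + (3/4)(1/4 + 1/24) + 1/64`, and `δ < 1/4` is
  -- strict.
  nlinarith

/-! ### A hidden cluster -/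

/-- Even with `k ≤ m/40` zeros revealed, with probability at least `1/2` more than `0.6 m` of the
cluster's labels are ones. Then `0` loses more than `0.6 m`, and `e_j` less than `0.4 m`. -/
lemma half_le_bernExp_failInd_zero {n d m k : ℕ} (g : Fin n → Fin d)
    (hg : ∀ j, (univ.filter fun i => g i = j).card = m) (j : Fin d) {ε : ℝ} (hε : 0 < ε)
    (hε1 : ε < 1 / 10) (hm : 50 ≤ m) (hk : 40 * k ≤ m) {p : Fin n → ℝ}
    (hp : ∀ i, p i = 0 ∨ (i ∈ univ.filter (fun i => g i = j) ∧ p i = 3 / 4))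
    (hcard : ((univ.filter fun i => g i = j).filter fun i => p i = 0).card ≤ k) :
    1 / 2 ≤ bernExp p (fun y => failInd (clusterMatrix g) ε 0 (labels y)) := by
  have hm' : (50 : ℝ) ≤ m := by exact_mod_cast hm
  have hk' : 40 * (k : ℝ) ≤ m := by exact_mod_cast hk
  have hIcc : ∀ i, p i ∈ Set.Icc (0 : ℝ) 1 := fun i => by
    rcases hp i with h | ⟨-, h⟩ <;> rw [h] <;> norm_num
  have hmean : 3 / 4 * ((m : ℝ) - k) ≤ ∑ i with g i = j, p i := by
    have h1 : ∀ i ∈ univ.filter (fun i => g i = j),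
        (3 / 4 : ℝ) * (1 - if p i = 0 then 1 else 0) ≤ p i := by
      intro i _
      rcases hp i with h | ⟨-, h⟩ <;> norm_num [h]
    refine le_trans ?_ (sum_le_sum h1)
    rw [← mul_sum, sum_sub_distrib, ← sum_filter, sum_const, sum_const, hg]
    have : (((univ.filter fun i => g i = j).filter fun i => p i = 0).card : ℝ) ≤ k := by
      exact_mod_cast hcard
    simp only [nsmul_eq_mul, mul_one]
    linarith
  have h := le_bernExp_of_close hIcc (univ.filter fun i => g i = j) (t := (m : ℝ) / 10)
    (by linarith) (f := fun y => failInd (clusterMatrix g) ε 0 (labels y))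
    (fun y => failInd_nonneg _ _ _ _) (fun y hc hy => by
      refine (failInd_eq_one (Pi.single j 1) ?_).ge
      have hout : ∀ i, g i ≠ j → bit (y i) = 0 := fun i hi => by
        have : p i = 0 := by
          rcases hp i with h | ⟨h, -⟩
          · exact h
          · exact absurd (mem_filter.1 h).2 hi
        rw [(hc i).2 this]; rfl
      have e0 : l1Loss (clusterMatrix g) (labels y) 0 = ∑ i with g i = j, bit (y i) := by
        rw [l1Loss_clusterMatrix, sum_filter]
        refine sum_congr rfl fun i _ => ?_
        split_ifs with hi
        · cases h : y i <;> simp [labels, h]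
        · simp [labels, hout i hi]
      have e1 : l1Loss (clusterMatrix g) (labels y) (Pi.single j 1)
          = m - ∑ i with g i = j, bit (y i) := by
        have : (m : ℝ) = ∑ i with g i = j, (1 : ℝ) := by simp [hg]
        rw [l1Loss_clusterMatrix, this, ← sum_sub_distrib, sum_filter]
        refine sum_congr rfl fun i _ => ?_
        split_ifs with hi
        · cases h : y i <;> simp [labels, h, hi]
        · simp [labels, hout i hi, hi]
      rw [e0, e1]
      rw [sum_sub_distrib] at hy
      have := (abs_lt.1 hy).1
      set Y := ∑ i with g i = j, bit (y i)
      have hY : 0.6 * (m : ℝ) < Y := by linarith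
      nlinarith)
  refine le_trans ?_ h
  rw [hg]
  have h1 : (m : ℝ) / (4 * (m / 10) ^ 2) = 25 / m := by
    field_simp; norm_num
  have h2 : 25 / (m : ℝ) ≤ 1 / 2 := by
    rw [div_le_div_iff₀ (by linarith) (by norm_num)]; linarith
  rw [h1]; linarith

theorem hidden_cluster_lower_bound {n d m : ℕ} (g : Fin n → Fin d)
    (hg : ∀ j, (univ.filter fun i => g i = j).card = m) (hd : 0 < d) {ε δ T : ℝ} (hε : 0 < ε)
    (hε1 : ε < 1 / 10) (hδ : 0 < δ) (hδ1 : δ < 1 / 16) (hT0 : T ≤ d * Real.log (1 / δ) / 4)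
    (hm : 50 ≤ m) (hmT : 40 * T ≤ m) (L : RandomizedLearner.{u} n d)
    (hsolve : ∀ y : Fin n → ℝ, 1 - δ ≤ L.law.real {ω | ∀ β : Fin d → ℝ,
      l1Loss (clusterMatrix g) y ((L.tree ω).run y) ≤ (1 + ε) * l1Loss (clusterMatrix g) y β})
    (hT : ∀ y : Fin n → ℝ, L.law {ω | T ≤ ((L.tree ω).numQueries y : ℝ)} = 0) : False := by
  have hd' : (0 : ℝ) < d := by exact_mod_cast hd
  set p : Option (Fin d) → Fin n → ℝ :=
    fun o i => if some (g i) = o then 3 / 4 else 0 with hpdef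
  have hp : ∀ o i, p o i ∈ Set.Icc (0 : ℝ) 1 := fun o i => by
    simp only [hpdef]; split_ifs <;> norm_num
  obtain ⟨t, htT, ht⟩ := L.exists_tree (clusterMatrix g) ε δ T hsolve hT
    (fun o : Option (Fin d) => o.elim (1 / 2 : ℝ) fun _ => 1 / (2 * d))
    (fun o => by cases o <;> simp) (by
      rw [Fintype.sum_option]
      simp
      field_simp
      norm_num) p hp
  rw [Fintype.sum_option] at ht
  simp only [Option.elim] at ht
  have hT1 : 0 ≤ T := le_trans (Nat.cast_nonneg _) (htT fun _ => false).le
  have hkT : (⌊T⌋₊ : ℝ) ≤ T := Nat.floor_le hT1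
  have hlab : labels (fun _ : Fin n => false) = 0 := by ext; simp [labels]
  have hnone : bernExp (p none)
      (fun y => failInd (clusterMatrix g) ε (t.run (labels y)) (labels y))
      = failInd (clusterMatrix g) ε (t.run 0) 0 := by
    rw [← bernExp_const (p none) (failInd (clusterMatrix g) ε (t.run 0) 0)]
    refine bernExp_congr fun y hy => ?_
    have : y = fun _ => false := funext fun i => (hy i).2 (by simp [hpdef])
    rw [this, hlab]
  rw [hnone] at ht
  have hE0 : ∀ j, 0 ≤ bernExp (p (some j))
      (fun y => failInd (clusterMatrix g) ε (t.run (labels y)) (labels y)) := fun j =>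
    bernExp_nonneg (hp _) fun y => failInd_nonneg _ _ _ _
  have hS0 : 0 ≤ ∑ j, 1 / (2 * d) * bernExp (p (some j))
      (fun y => failInd (clusterMatrix g) ε (t.run (labels y)) (labels y)) :=
    sum_nonneg fun j _ => mul_nonneg (by positivity) (hE0 j)
  -- The all-zero vector has prior weight `1/2 > δ` and minimal loss `0`, so only the exact output
  -- `0` is acceptable.
  have hrun : t.run 0 = 0 := by
    by_contra hne
    obtain ⟨j, hj⟩ := Function.ne_iff.1 hne
    obtain ⟨i, hi⟩ : (univ.filter fun i => g i = j).Nonempty := by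
      rw [← card_pos, hg]; omega
    have h1 : failInd (clusterMatrix g) ε (t.run 0) 0 = 1 := by
      refine failInd_eq_one 0 ?_
      rw [l1Loss_clusterMatrix, l1Loss_clusterMatrix]
      simp only [Pi.zero_apply, sub_zero, abs_zero, sum_const_zero, mul_zero]
      refine sum_pos' (fun _ _ => abs_nonneg _) ⟨i, mem_univ i, ?_⟩
      rw [(mem_filter.1 hi).2]
      exact abs_pos.2 hj
    rw [h1] at ht
    linarith
  have hf0 := failInd_nonneg (clusterMatrix g) ε (t.run 0) 0
  set N : Fin d → ℕ := fun j => t.numQueriesIn {i | g i = j} 0 with hN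
  have hNq : t.numQueries 0 ≤ ⌊T⌋₊ := by
    have := Nat.le_floor (htT fun _ => false).le
    rwa [hlab] at this
  have hNsum : ∑ j, (N j : ℝ) ≤ T := by
    have h1 := t.sum_numQueriesIn g 0
    have h2 : ∑ j, (N j : ℝ) = t.numQueries 0 := by exact_mod_cast h1
    rw [h2]
    exact le_trans (by exact_mod_cast hNq) hkT
  set s := Real.exp (-(Real.log (1 / δ) / 2)) with hs
  have hs2 : s ^ 2 = δ := exp_half_log_sq hδ
  have hs0 : 0 < s := Real.exp_pos _
  have hexp : Real.exp (-2) ≤ 1 / 4 := by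
    have h1 := Real.add_one_le_exp 1
    have h2 : Real.exp (-2) * (Real.exp 1 * Real.exp 1) = 1 := by
      rw [← Real.exp_add, ← Real.exp_add]; norm_num
    have h3 : 4 ≤ Real.exp 1 * Real.exp 1 := by nlinarith
    nlinarith [Real.exp_pos (-2)]
  -- The tangent line of the exponential turns the bound `4^(-N j)` into one linear in `N j`, so
  -- only the total number of queries enters after summing over `j`.
  have hj : ∀ j, 1 / 2 * (s * (1 + Real.log (1 / δ) / 2 - 2 * N j)) ≤ bernExp (p (some j))
      (fun y => failInd (clusterMatrix g) ε (t.run (labels y)) (labels y)) := by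
    intro j
    have h1 := QueryTree.le_bernExp_zero_path ⌊T⌋₊ {i | g i = j} 0
      (fun b y => failInd (clusterMatrix g) ε b (labels y)) (fun b y => failInd_nonneg _ _ _ _)
      (fun q hq hc => half_le_bernExp_failInd_zero g hg j hε hε1 hm (by
        have : 40 * (⌊T⌋₊ : ℝ) ≤ m := by linarith
        exact_mod_cast this) hq hc)
      t (p (some j)) (fun i => by
        by_cases hi : g i = j
        · right; simp [hpdef, hi]
        · left; simp [hpdef, hi])
      (by
        have : ((univ.filter fun i => g i = j).filter fun i => p (some j) i = 0) = ∅ := by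
          refine filter_eq_empty_iff.2 fun i hi => ?_
          simp [hpdef, (mem_filter.1 hi).2]
        rw [this, card_empty, zero_add]
        exact (t.numQueriesIn_le _ _).trans hNq)
      hrun
    refine le_trans (mul_le_mul_of_nonneg_left ?_ (by norm_num)) h1
    calc s * (1 + Real.log (1 / δ) / 2 - 2 * N j)
        ≤ s * Real.exp (Real.log (1 / δ) / 2 - 2 * N j) := by
          refine mul_le_mul_of_nonneg_left ?_ hs0.le
          have := Real.add_one_le_exp (Real.log (1 / δ) / 2 - 2 * N j)
          linarith
      _ = Real.exp (-2) ^ N j := by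
          rw [hs, ← Real.exp_add, ← Real.exp_nat_mul]
          congr 1; ring
      _ ≤ _ := pow_le_pow_left₀ (Real.exp_pos _).le hexp _
  have hsum := sum_le_sum fun j (_ : j ∈ (univ : Finset (Fin d))) => hj j
  simp only [← mul_sum, sum_sub_distrib, sum_const, card_univ, Fintype.card_fin,
    nsmul_eq_mul] at hsum ht
  set E := ∑ j, bernExp (p (some j))
    (fun y => failInd (clusterMatrix g) ε (t.run (labels y)) (labels y))
  have h3 : 1 / 2 * (s * d) ≤ E := by
    refine le_trans ?_ hsum
    refine mul_le_mul_of_nonneg_left (mul_le_mul_of_nonneg_left ?_ hs0.le) (by norm_num)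
    nlinarith
  have h4 : 1 / (2 * d) * E ≤ δ := by linarith
  have h5 : E ≤ δ * (2 * d) := by
    rw [div_mul_eq_mul_div, one_mul, div_le_iff₀ (by positivity)] at h4
    exact h4
  have h6 : 1 / 2 * s ≤ 2 * δ := by
    have : d * (1 / 2 * s) ≤ d * (2 * δ) := by linarith
    exact le_of_mul_le_mul_left this hd'
  -- Now `s / 2 ≤ 2 s²` with `s = √δ`, contradicting `δ < 1/16`.
  nlinarith

/-! ### Equal clusters and the combination of the three bounds -/

lemma card_finProd_fiber (d m : ℕ) (j : Fin d) :
    (univ.filter fun i : Fin (d * m) => (finProdFinEquiv.symm i).1 = j).card = m := by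
  have : (univ.filter fun i : Fin (d * m) => (finProdFinEquiv.symm i).1 = j)
      = (univ : Finset (Fin m)).map
        ⟨fun k => finProdFinEquiv (j, k), fun a b h => by simpa using h⟩ := by
    ext i
    simp only [mem_filter, mem_univ, true_and, mem_map]
    constructor
    · rintro rfl
      exact ⟨(finProdFinEquiv.symm i).2, finProdFinEquiv.apply_symm_apply i⟩
    · rintro ⟨k, rfl⟩
      exact congrArg Prod.fst (finProdFinEquiv.symm_apply_apply (j, k))
  rw [this, card_map, card_univ, Fintype.card_fin]

end ActiveL1

open ActiveL1 in
theorem mainTheorem4 :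
    ∃ (c : ℝ) (p : MvPolynomial (Fin 3) ℝ), 0 < c ∧
      ∀ (d : ℕ) (ε δ : ℝ), 1 ≤ d → 0 < ε → ε < 1 / 10 → 0 < δ → δ < 1 / 4 →
        ∃ n : ℕ, (n : ℝ) ≤ MvPolynomial.eval ![(d : ℝ), 1 / ε, Real.log (1 / δ)] p ∧
          ∀ A : ActiveL1.Algorithm.{u} n d, A.Solves ε δ →
            ∃ (X : Matrix (Fin n) (Fin d) ℝ) (y : Fin n → ℝ),
              0 < (A X).law {ω | c * (d * Real.log (1 / δ) + d / ε ^ 2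
                + 1 / ε ^ 2 * Real.log (1 / δ)) ≤ (((A X).tree ω).numQueries y : ℝ)} := by
  -- For `δ ≥ 1/64` the three terms sum to at most `8 d/ε²`, so `c = 2^(-14) / 8` suffices; the
  -- other case leaves room to spare.
  refine ⟨1 / 2 ^ 17, 400 * MvPolynomial.X 0 ^ 2 * (MvPolynomial.X 1 + 1) ^ 3 *
    (MvPolynomial.X 2 + 1), by positivity, ?_⟩
  intro d ε δ hd hε hε1 hδ hδ1
  set l := Real.log (1 / δ) with hl
  have hd' : (1 : ℝ) ≤ d := by exact_mod_cast hd
  have hu : 10 < 1 / ε := by rw [lt_div_iff₀ hε]; linarith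
  have hl1 : 1 ≤ l := by
    rw [hl, Real.le_log_iff_exp_le (by positivity), le_div_iff₀ hδ]
    nlinarith [Real.exp_one_lt_d9]
  -- The factor `d` makes a cluster outnumber the queries in the hidden-cluster bound; `ε⁻³` gives
  -- `4T ≤ ε n` in the one-cluster bound with `T` of order `l/ε²`.
  set m : ℕ := 400 * d * ⌈1 / ε⌉₊ ^ 3 * ⌈l⌉₊ with hm
  have hu1 := Nat.le_ceil (1 / ε)
  have hu2 := (Nat.ceil_lt_add_one (show 0 ≤ 1 / ε by positivity)).le
  have hl2 := Nat.le_ceil l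
  have hl3 := (Nat.ceil_lt_add_one (show 0 ≤ l by linarith)).le
  have hmlow : 400 * d * (1 / ε) ^ 3 * l ≤ (m : ℝ) := by
    rw [hm]; push_cast
    gcongr
  refine ⟨d * m, ?_, ?_⟩
  · simp only [map_mul, map_pow, map_add, map_one, map_ofNat, MvPolynomial.eval_X,
      Matrix.cons_val_zero, Matrix.cons_val_one, Matrix.cons_val]
    rw [hm]; push_cast
    calc (d : ℝ) * (400 * d * (⌈1 / ε⌉₊ : ℝ) ^ 3 * ⌈l⌉₊)
        = 400 * (d : ℝ) ^ 2 * (⌈1 / ε⌉₊ : ℝ) ^ 3 * ⌈l⌉₊ := by ring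
      _ ≤ 400 * (d : ℝ) ^ 2 * (1 / ε + 1) ^ 3 * (l + 1) := by gcongr
  clear_value m
  intro A hA
  by_contra hcon
  push Not at hcon
  have hnull : ∀ T : ℝ, 1 / 2 ^ 17 * (d * l + d / ε ^ 2 + 1 / ε ^ 2 * l) ≤ T →
      ∀ (X : Matrix (Fin (d * m)) (Fin d) ℝ) (y : Fin (d * m) → ℝ),
        (A X).law {ω | T ≤ (((A X).tree ω).numQueries y : ℝ)} = 0 := by
    intro T hT X y
    refine MeasureTheory.measure_mono_null (fun ω hω => ?_) (le_antisymm (hcon X y) zero_le)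
    exact hT.trans hω
  have hv0 : 0 < 1 / ε := by positivity
  have hε2 : 1 / ε ^ 2 = (1 / ε) ^ 2 := by rw [one_div_pow]
  have hv2 : 100 ≤ (1 / ε) ^ 2 := by nlinarith
  have hm1 : 400 * (1 / ε) ^ 3 * l ≤ (m : ℝ) := by
    refine le_trans ?_ hmlow
    have : 0 ≤ (1 / ε) ^ 3 * l := by positivity
    nlinarith
  have hu3 : 1000 ≤ (1 / ε) ^ 3 := by
    calc (1000 : ℝ) = 10 ^ 3 := by norm_num
      _ ≤ _ := pow_le_pow_left₀ (by norm_num) hu.le 3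
  have hm2 : 400000 ≤ (m : ℝ) := by nlinarith
  have hεm : 384 ≤ ε ^ 2 * m := by
    have h1 : ε ^ 2 * (400 * (1 / ε) ^ 3 * l) = 400 * (1 / ε) * l := by field_simp
    nlinarith [mul_le_mul_of_nonneg_left hm1 (sq_nonneg ε)]
  have hmany : ¬ 1 / 2 ^ 17 * (d * l + d / ε ^ 2 + 1 / ε ^ 2 * l) ≤ d / (2 ^ 14 * ε ^ 2) :=
    fun h => many_clusters_lower_bound _ (card_finProd_fiber d m) hd hε hε1 hδ1 le_rfl hεm
      (A _) (hA _) (hnull _ h _)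
  have hde : (d : ℝ) / ε ^ 2 = d * (1 / ε) ^ 2 := by field_simp
  have hde2 : (d : ℝ) / (2 ^ 14 * ε ^ 2) = 1 / 2 ^ 14 * (d * (1 / ε) ^ 2) := by field_simp
  rw [hde, hε2] at hnull hmany
  rw [hde2] at hmany
  have hdv : 0 ≤ d * (1 / ε) ^ 2 := by positivity
  by_cases hδ2 : δ < 1 / 64
  · have hhid : ¬ 1 / 2 ^ 17 * (d * l + d * (1 / ε) ^ 2 + (1 / ε) ^ 2 * l) ≤ d * l / 4 :=
      fun h => hidden_cluster_lower_bound _ (card_finProd_fiber d m) hd hε hε1 hδ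
        (by linarith) le_rfl (by exact_mod_cast (show (50 : ℝ) ≤ m by linarith))
        (by
          refine le_trans ?_ hmlow
          have : d * l * 1 ≤ d * l * (1 / ε) ^ 3 := by gcongr; linarith
          nlinarith) (A _) (hA _) (hnull _ h _)
    have hone : ¬ 1 / 2 ^ 17 * (d * l + d * (1 / ε) ^ 2 + (1 / ε) ^ 2 * l)
        ≤ l / (64 * ε ^ 2) := fun h =>
      have hmd : (m : ℝ) ≤ ((d * m : ℕ) : ℝ) := by
        push_cast; nlinarith
      one_cluster_lower_bound ⟨0, hd⟩ hε hε1 hδ hδ2 le_rfl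
        (by nlinarith [mul_le_mul_of_nonneg_left hmd (sq_nonneg ε)])
        (by
          refine le_trans ?_ (mul_le_mul_of_nonneg_left (hm1.trans hmd) hε.le)
          have e1 : ε * (400 * (1 / ε) ^ 3 * l) = 400 * (l / ε ^ 2) := by field_simp
          have e2 : 4 * (l / (64 * ε ^ 2)) = 1 / 16 * (l / ε ^ 2) := by field_simp; norm_num
          have e3 : 0 ≤ l / ε ^ 2 := by positivity
          rw [e1, e2]; linarith) (A _) (hA _) (hnull _ h _)
    have e4 : l / (64 * ε ^ 2) = 1 / 64 * ((1 / ε) ^ 2 * l) := by field_simp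
    rw [e4] at hone
    -- If all three bounds fail to apply, then the sum of the three terms is less than `c (2^14 + 4
    -- + 64)` times itself, while that factor is below `1`.
    linarith
  -- When `δ` is not small, `l` is bounded, so `d/ε²` dominates and the many-cluster bound alone
  -- suffices.
  · have hl5 : l ≤ 6 := by
      have h1 : 1 / δ ≤ 64 := by rw [div_le_iff₀ hδ]; linarith
      have h2 : l ≤ Real.log 64 := Real.log_le_log (by positivity) h1
      have h3 : Real.log 64 = 6 * Real.log 2 := by
        rw [show (64 : ℝ) = 2 ^ 6 by norm_num, Real.log_pow]; norm_num
      linarith [Real.log_two_lt_d9]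
    refine hmany ?_
    have hd0 : (0 : ℝ) ≤ d := by linarith
    have h1 : d * l ≤ d * (1 / ε) ^ 2 * (6 / 100) := by
      rw [mul_assoc]
      exact mul_le_mul_of_nonneg_left (by linarith) hd0
    have h2 : (1 / ε) ^ 2 * l ≤ d * (1 / ε) ^ 2 * 6 :=
      mul_le_mul (le_mul_of_one_le_left (by linarith) hd') hl5 (by linarith) hdv
    linarith
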